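/- **Computations.** A future-parallel computation is a finite directed acyclic graph with three kinds of edges: continuation edges (from a node to the next node of the same thread), future edges (from a fork to the first node of the thread spawned there, the future thread of the fork) and touch edges (from a node of a future thread to a node of another thread, called a touch of that future thread). A thread is a maximal chain of continuation edges; the main thread goes from the root (the only node of in-degree 0) to the final node (the only node of out-degree 0); every other thread starts at the head of a future edge, and its last node has exactly one outgoing edge, a touch edge. All other in- and out-degrees are 1 or 2; a fork has exactly one continuation edge, to its right child, and one future edge, to its left child, and both children have in-degree 1; a node of in-degree 2 is a touch and has one incoming continuation edge, from its local parent, and one incoming touch edge. A node $w$ is a descendant of $v$ if there is a directed path from $v$ to $w$. The computation is *structured* if for every fork $v$ with future thread $t$ the local parents of the touches of $t$ are descendants of $v$ and at least one touch of $t$ is a descendant of the right child of $v$. It is a structured *local-touch* computation if moreover, for every fork $v$ with future thread $t$, all touches of $t$ lie in the parent thread (the thread containing $v$) and are descendants of the right child of $v$. The span $T_\infty$ is the length (number of edges) of a longest directed path. **Work stealing.** Each of $P\ge 1$ processors has a deque. Initially one processor is about to execute the root and all deques are empty. A step of a processor that has a current node executes it. If this enables children (i.e. all their parents have now been executed), the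 processor continues with one of them and pushes the other one, if there are two, onto the bottom of its deque: at a fork it continues with the future thread and pushes the right child; at a node with a continuation edge and a touch edge that are both enabled it continues with its own thread and pushes the touch. If no child is enabled, it pops a node from the bottom of its deque, if there is one. A step of a processor without a current node is a steal attempt: a victim is drawn uniformly from the $P$ processors, independently of the past, and the node at the top of the victim's deque is taken if there is one. An adaptive adversary chooses, knowing all past random draws, which processor takes the next step, subject only to the rule that between two steal attempts of the same processor every other processor takes at least one step (thieves yield to all). The sequential execution is the execution with one processor. **Costs.** A deviation is a node $v_2$ that has a predecessor $v_1$ in the order of the sequential execution and that is executed in the parallel execution by some processor $p$, but not immediately after $v_1$ among the nodes that $p$ executes. Each node accesses a finite sequence of memory blocks; each processor has its own, initially empty, fully associative LRU cache with $C$ lines. The number of additional cache misses is the excess (if positive) of the total number of cache misses of the parallel execution over that of the sequential execution. **Theorem.** There is an absolute constant $K$ such that, for every structured local-touch computation of span $T_\infty$, every number $P$ of processors and every admissible adversary, the work-stealing execution in which every fork runs the future thread first incurs in expectation at most $K\,P\,T_\infty^2$ deviations and, for every $C$ and every assignment of memory accesses to the nodes, at most $K\,C\,P\,T_\infty^2$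 additional cache misses. -/

import Mathlib

open Relation MeasureTheory
open scoped ENNReal

/-- The edges of a future-parallel computation: a node has at most one outgoing edge of each kind.
`cont u` is the next node of the thread of `u` (continuation edge), `future u` is the first node
of the thread spawned at `u` (future edge), `touch u` is the node that touches, through `u`,
the future computed by the thread of `u` (touch edge). -/
structure FutureGraph (V : Type*) where
  root : V
  final : V
  cont : V → Option V
  future : V → Option V
  touch : V → Option V

namespace FutureGraph

variable {V : Type*}

/-- There is an edge, of some kind, from `u` to `v`. -/
abbrev Edge (G : FutureGraph V) (u v : V) : Prop :=
  G.cont u = some v ∨ G.future u = some v ∨ G.touch u = some v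

/-- `v` is a (proper) descendant of `u`: there is a directed path from `u` to `v`. -/
def Descendant (G : FutureGraph V) (u v : V) : Prop := TransGen G.Edge u v

/-- `v` is `u` or comes after `u` in the thread of `u`. In particular, if `s` is the first node
of a thread then `G.Follows s u` says that `u` is a node of that thread. -/
def Follows (G : FutureGraph V) (u v : V) : Prop := ReflTransGen (fun a b => G.cont a = some b) u v

/-- `u` and `v` are nodes of the same thread. -/
def SameThread (G : FutureGraph V) (u v : V) : Prop := G.Follows u v ∨ G.Follows v u

/-- The computation span: the number of edges of a longest directed path. -/
noncomputable def span (G : FutureGraph V) : ℕ :=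
  sSup {n : ℕ | ∃ π : Fin (n + 1) → V, ∀ i : Fin n, G.Edge (π i.castSucc) (π i.succ)}

/-- The conventions on computation DAGs. A fork is a node with an outgoing future edge; its left
child is `future u` and its right child is `cont u`. -/
structure IsComputationDag (G : FutureGraph V) : Prop where
  acyclic : ∀ v, ¬ G.Descendant v v
  /-- A node has at most one incoming edge of each kind. -/
  cont_inj : ∀ u u' v, G.cont u = some v → G.cont u' = some v → u = u'
  future_inj : ∀ u u' v, G.future u = some v → G.future u' = some v → u = u'
  touch_inj : ∀ u u' v, G.touch u = some v → G.touch u' = some v → u = u'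
  root_in : ∀ u, ¬ G.Edge u G.root
  /-- Every thread other than the main thread begins at a node with an incoming future edge. -/
  exists_in : ∀ v, v ≠ G.root → (∃ u, G.cont u = some v) ∨ ∃ u, G.future u = some v
  /-- A fork has out-degree two: one continuation edge and one future edge. -/
  fork_out : ∀ u, G.future u ≠ none → G.cont u ≠ none ∧ G.touch u = none
  /-- Both children of a fork have in-degree one (so they are not touches). -/
  left_child_in : ∀ u v w, G.future u = some v → G.cont w ≠ some v ∧ G.touch w ≠ some v
  right_child_in : ∀ u v w, G.future u ≠ none → G.cont u = some v → G.touch w ≠ some v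
  /-- The main thread begins at the root node and ends at the final node. -/
  main_thread : G.Follows G.root G.final
  final_out : ∀ v, ¬ G.Edge G.final v
  /-- The last node of every other thread has an outgoing touch edge. -/
  last_touch : ∀ v, v ≠ G.final → G.cont v = none → G.touch v ≠ none
  /-- A touch edge leaves a thread that computes a future, i.e. a thread spawned at some fork, -/
  touch_source : ∀ u v, G.touch u = some v → ∃ f s, G.future f = some s ∧ G.Follows s u
  /-- and it is directed to another thread. -/
  touch_target : ∀ u v, G.touch u = some v → ¬ G.SameThread u v

/-- Structured future-parallel computations: for the future thread (first node `s`) of any fork `f`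
with right child `r`, the local parents of the touches of that thread are descendants of `f`,
and at least one touch of that thread is a descendant of `r`. -/
def IsStructured (G : FutureGraph V) : Prop :=
  ∀ f s r, G.future f = some s → G.cont f = some r →
    (∀ w x l, G.Follows s w → G.touch w = some x → G.cont l = some x → G.Descendant f l) ∧
    ∃ w x, G.Follows s w ∧ G.touch w = some x ∧ G.Descendant r x

/-- Structured local-touch computations: moreover, the future thread of a fork `f` is touched only
at nodes of its parent thread (the thread of `f`) that are descendants of the right child of `f`. -/
def IsStructuredLocalTouch (G : FutureGraph V) : Prop :=
  G.IsStructured ∧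
    ∀ f s r w x, G.future f = some s → G.cont f = some r →
      G.Follows s w → G.touch w = some x → G.SameThread f x ∧ G.Descendant r x

end FutureGraph

/-- A configuration of `P` processors executing a computation. -/
structure WSState (V : Type*) (P : ℕ) where
  /-- the node that a processor is about to execute, if any -/
  current : Fin P → Option V
  /-- the deque of a processor; the head of the list is the bottom of the deque -/
  deque : Fin P → List V
  /-- the nodes that a processor has executed so far, in chronological order -/
  trace : Fin P → List V

/-- An adaptive (kernel) adversary: from the random draws made so far it chooses
the processor that takes the next step. -/
abbrev Adversary (P : ℕ) := List (Fin P) → Fin P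

namespace FutureGraph

variable {V : Type*} [Fintype V] [DecidableEq V] {P : ℕ}

/-- In the configuration `s`, the children of `v` all of whose parents have been executed:
at a fork the future thread comes first, at the other nodes the thread of `v` does. -/
def enabled (G : FutureGraph V) (s : WSState V P) (v : V) : List V :=
  ((G.future v).toList ++ (G.cont v).toList ++ (G.touch v).toList).filter
    fun w => decide (∀ u, G.Edge u w → ∃ p, u ∈ s.trace p)

/-- Processor `p` executes the node `v`. The enabled children of `v` go to the bottom of
the deque of `p` (a first enabled child bottommost), and then `p` takes the bottom of its deque. Thus
`p` continues with the first enabled child of `v` while a second one stays in the deque, and if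
no child of `v` is enabled then `p` pops its deque. -/
def execStep (G : FutureGraph V) (s : WSState V P) (p : Fin P) (v : V) : WSState V P :=
  let s' : WSState V P := { s with trace := Function.update s.trace p (s.trace p ++ [v]) }
  let d := G.enabled s' v ++ s.deque p
  { s' with
    current := Function.update s.current p d.head?
    deque := Function.update s.deque p d.tail }

/-- Processor `p` attempts to steal the top node of the deque of `q`. -/
def stealStep (s : WSState V P) (p q : Fin P) : WSState V P :=
  match (s.deque q).getLast? with
  | none => s
  | some w =>
    { s with
      current := Function.update s.current p (some w)
      deque := Function.update s.deque q (s.deque q).dropLast }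

/-- One step of processor `p`: it executes its current node, or, if it has none (its deque
is empty then), it makes one attempt to steal from the processor `q`. -/
def wsStep (G : FutureGraph V) (s : WSState V P) (p q : Fin P) : WSState V P :=
  match s.current p with
  | some v => G.execStep s p v
  | none => stealStep s p q

/-- Initially processor `p₀` is about to execute the root; all deques are empty. -/
def initState (G : FutureGraph V) (p₀ : Fin P) : WSState V P where
  current := Function.update (fun _ => none) p₀ (some G.root)
  deque := fun _ => []
  trace := fun _ => []

/-- The processor that takes step `n`, if the random draws are `ω 0, ω 1, …`. -/
def scheduled (adv : Adversary P) (ω : ℕ → Fin P) (n : ℕ) : Fin P := adv ((List.range n).map ω)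

/-- The configuration after `n` steps; `ω n` is the victim if step `n` is a steal attempt. -/
def run (G : FutureGraph V) (p₀ : Fin P) (adv : Adversary P) (ω : ℕ → Fin P) : ℕ → WSState V P
  | 0 => G.initState p₀
  | n + 1 => G.wsStep (G.run p₀ adv ω n) (scheduled adv ω n) (ω n)

/-- Step `n` is a steal attempt. -/
def StealAttempt (G : FutureGraph V) (p₀ : Fin P) (adv : Adversary P) (ω : ℕ → Fin P)
    (n : ℕ) : Prop :=
  (G.run p₀ adv ω n).current (scheduled adv ω n) = none

/-- Thieves yield to all: between two steal attempts of a processor,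
every other processor takes at least one step. -/
def YieldToAll (G : FutureGraph V) (p₀ : Fin P) (adv : Adversary P) : Prop :=
  ∀ ω m n, m < n → scheduled adv ω m = scheduled adv ω n →
    G.StealAttempt p₀ adv ω m → G.StealAttempt p₀ adv ω n →
      ∀ q, q ≠ scheduled adv ω n → ∃ k, m < k ∧ k < n ∧ scheduled adv ω k = q

/-- The order in which the nodes are executed by a single processor. -/
def seqOrder (G : FutureGraph V) : List V :=
  (G.run (P := 1) 0 (fun _ => 0) (fun _ => 0) (Fintype.card V)).trace 0

/-- `x` has been executed by some processor `p`, but not immediately after the node `y` that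
precedes `x` in the sequential execution. -/
def IsDeviation (G : FutureGraph V) (s : WSState V P) (x : V) : Prop :=
  ∃ y p, [y, x] <:+: G.seqOrder ∧ x ∈ s.trace p ∧ ¬ [y, x] <:+: s.trace p

/-- The number of deviations of an execution. -/
noncomputable def deviations (G : FutureGraph V) (p₀ : Fin P) (adv : Adversary P)
    (ω : ℕ → Fin P) : ℝ≥0∞ :=
  ⨆ n, (({x | G.IsDeviation (G.run p₀ adv ω n) x}.ncard : ℕ) : ℝ≥0∞)

end FutureGraph

/-- The number of misses of a fully associative LRU cache with `C` lines on a sequence of accesses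
to memory blocks. The first list is the content of the cache, most recently used block first. -/
def lruMisses {M : Type*} [DecidableEq M] (C : ℕ) : List M → List M → ℕ
  | _, [] => 0
  | c, b :: bs => (if b ∈ c then 0 else 1) + lruMisses C ((b :: c.erase b).take C) bs

namespace FutureGraph

variable {V : Type*} [Fintype V] [DecidableEq V] {P : ℕ} {M : Type*} [DecidableEq M]

/-- The total number of cache misses of an execution, if each processor has its own, initially
empty, cache with `C` lines and node `v` accesses the memory blocks `access v`, in this order. -/
noncomputable def cacheMisses (G : FutureGraph V) (C : ℕ) (access : V → List M) (p₀ : Fin P)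
    (adv : Adversary P) (ω : ℕ → Fin P) : ℝ≥0∞ :=
  ⨆ n, ((∑ p, lruMisses C [] (((G.run p₀ adv ω n).trace p).flatMap access) : ℕ) : ℝ≥0∞)

/-- The number of cache misses of the sequential execution. -/
def seqCacheMisses (G : FutureGraph V) (C : ℕ) (access : V → List M) : ℕ :=
  lruMisses C [] (G.seqOrder.flatMap access)

end FutureGraph

/-- The law of the random draws: independent and uniform on the `P` processors. -/
noncomputable def victimLaw (P : ℕ) [NeZero P] : Measure (ℕ → Fin P) :=
  Measure.infinitePi fun _ => (PMF.uniformOfFintype (Fin P)).toMeasure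

/-!
Two estimates give the theorem: an execution with `S` stolen nodes has at most `3 * T * S`
deviations, where `T` is the span, and the expected number of steals is of order `P * T`.

**Deviations.** The processor that executes a fork `f` runs the future thread of `f` while the right
child `r` of `f` waits in its deque. Likewise a touch waits in a deque only while its processor
continues the thread that has just enabled it. So a node `y` of a deque and the node before it are
related by `Linked`, because no touch of the thread being executed can be enabled while `y` waits
(`Linked.not_ready_touch`). Hence a node is popped early only if the thread it waits for has run
into a touch whose other parent is missing, a *blocked* touch (`IsExecution.origin`). If a touch `x`
of the future thread of `f` is blocked, let `y` be the last blocked touch of this future thread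
before `x` in the parent thread, or `r` if there is none. Then `y` has been stolen, or the future
thread has a blocked touch, one level deeper, after the node that touches `y` and up to the node
that touches `x` (`IsExecution.exists_charged`). The segments of the future thread that belong to
different `x` are disjoint, so each steal pays for at most one blocked touch on each of the at most
`T` levels (`IsExecution.card_blocked_le`). In particular nothing is ever blocked in the sequential
execution, which determines the sequential order (`seqOrder_pred`). A deviation is stolen, or
blocked, or the right child of a fork whose future thread contains a blocked touch
(`IsExecution.deviation_cases`).

**Cache misses.** Two LRU caches that agree on their `j` most recent blocks, on the same accesses,
differ in at most `C - j` further misses (`CacheClose.accesses`). So a processor has at most `C`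
additional misses for each deviation, because between two deviations it follows the sequential
order.

**Steals.** This is a potential argument in the manner of Arora, Blumofe and Plaxton. A node of
enabling depth `d` in a deque weighs `9 ^ (T - d)`, and a current node a third of that; depths
decrease towards the top of a deque, so the top node carries most of the potential of its processor.
The share of a current node is made to decay with the number of steal attempts since the last step
of its processor, which is at most `P` since thieves yield to all (`age_le`). Then each steal
attempt decreases the total potential `Φ`, in expectation, by a proportion `1 / (2 * P)`
(`sum_totalPotential_le`), and no other step increases it. Thus the expectation of `log (1 + Φ)`,
initially of order `T`, drops by `1 / (4 * P)` with each steal attempt made while some deque is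
nonempty (`sum_log_totalPotential_le`).
-/

/-! ### Threads, paths and depths -/

namespace FutureGraph

section Graph

variable {V : Type*} {G : FutureGraph V}

theorem Follows.refl (G : FutureGraph V) (u : V) : G.Follows u u := ReflTransGen.refl

theorem Follows.trans {u v w : V} (h₁ : G.Follows u v) (h₂ : G.Follows v w) : G.Follows u w :=
  ReflTransGen.trans h₁ h₂

theorem Follows.tail {u v w : V} (h₁ : G.Follows u v) (h₂ : G.cont v = some w) : G.Follows u w :=
  ReflTransGen.tail h₁ h₂

theorem follows_of_cont {u v : V} (h : G.cont u = some v) : G.Follows u v := ReflTransGen.single h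

theorem Follows.eq_or_descendant {u v : V} (h : G.Follows u v) : u = v ∨ G.Descendant u v := by
  rcases reflTransGen_iff_eq_or_transGen.1 h with h | h
  · exact Or.inl h.symm
  · exact Or.inr (TransGen.mono (fun _ _ h => Or.inl h) _ _ h)

/-- The nodes after a given node of a thread are linearly ordered. -/
theorem Follows.total {u v w : V} (h₁ : G.Follows u v) (h₂ : G.Follows u w) :
    G.Follows v w ∨ G.Follows w v :=
  ReflTransGen.total_of_right_unique
    (fun _ _ _ h h' => Option.some_injective _ (h.symm.trans h')) h₁ h₂

/-- A node with a continuation edge is followed by its successor before anything else. -/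
theorem Follows.cont_of_ne {u v w : V} (h : G.Follows u v) (hne : u ≠ v)
    (hw : G.cont u = some w) : G.Follows w v := by
  rcases ReflTransGen.cases_head h with rfl | ⟨c, hc, hcv⟩
  · exact absurd rfl hne
  · obtain rfl : c = w := Option.some_injective _ (hc.symm.trans hw)
    exact hcv

theorem Follows.eq_of_cont_none {u v : V} (h : G.Follows u v) (hu : G.cont u = none) : u = v := by
  rcases ReflTransGen.cases_head h with rfl | ⟨c, hc, -⟩
  · rfl
  · rw [hu] at hc; cases hc

namespace IsComputationDag

theorem follows_antisymm (h : G.IsComputationDag) {u v : V} (h₁ : G.Follows u v)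
    (h₂ : G.Follows v u) : u = v := by
  rcases h₁.eq_or_descendant with h' | h'
  · exact h'
  · rcases h₂.eq_or_descendant with h'' | h''
    · exact h''.symm
    · exact absurd (h'.trans h'') (h.acyclic u)

theorem not_follows_of_cont (h : G.IsComputationDag) {u v : V} (hc : G.cont u = some v) :
    ¬ G.Follows v u := fun h' =>
  have := h.follows_antisymm (follows_of_cont hc) h'
  h.acyclic u (.single (Or.inl (by rw [hc, ← this])))

theorem follows_pred (h : G.IsComputationDag) {u v l : V} (hf : G.Follows u v) (hne : u ≠ v)
    (hl : G.cont l = some v) : G.Follows u l := by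
  rcases ReflTransGen.cases_tail hf with rfl | ⟨c, hc, hcv⟩
  · exact absurd rfl hne
  · rwa [h.cont_inj l c v hl hcv]

/-- Each node lies on the thread of at most one fork. -/
theorem fork_unique (h : G.IsComputationDag) {f f' s s' a : V} (hf : G.future f = some s)
    (hf' : G.future f' = some s') (ha : G.Follows s a) (ha' : G.Follows s' a) : f = f' := by
  have key : s = s' := by
    have tot : G.Follows s s' ∨ G.Follows s' s := by
      induction ha with
      | refl => exact Or.inr ha'
      | @tail b c hb hbc ih =>
        by_cases hc : s' = c
        · exact Or.inl (hc ▸ Follows.tail hb hbc)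
        · exact ih (h.follows_pred ha' hc hbc)
    rcases tot with t | t
    · rcases ReflTransGen.cases_tail t with h' | ⟨c, -, hc⟩
      · exact h'.symm
      · exact absurd hc (h.left_child_in f' s' c hf').1
    · rcases ReflTransGen.cases_tail t with h' | ⟨c, -, hc⟩
      · exact h'
      · exact absurd hc (h.left_child_in f s c hf).1
  subst key
  exact h.future_inj f f' s hf hf'

/-- Every touch has a local parent. -/
theorem exists_localParent (h : G.IsComputationDag) {w x : V} (hw : G.touch w = some x) :
    ∃ l, G.cont l = some x := by
  have hx : x ≠ G.root := by
    rintro rfl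
    exact h.root_in w (Or.inr (Or.inr hw))
  rcases h.exists_in x hx with hl | ⟨u, hu⟩
  · exact hl
  · exact absurd hw (h.left_child_in u x w hu).2

theorem touch_ne_cont (h : G.IsComputationDag) {v x : V} (hx : G.touch v = some x) :
    G.cont v ≠ some x := fun hc =>
  h.touch_target v x hx (Or.inl (follows_of_cont hc))

end IsComputationDag

/-- In a local-touch computation the touches of the thread spawned at `f` come after the right
child of `f` in the thread of `f`. -/
theorem exists_fork_of_touch (h : G.IsComputationDag) (hs : G.IsStructuredLocalTouch) {w x : V}
    (hw : G.touch w = some x) :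
    ∃ f s r, G.future f = some s ∧ G.cont f = some r ∧ G.Follows s w ∧ G.Follows r x ∧ x ≠ r := by
  obtain ⟨f, s, hf, hsw⟩ := h.touch_source w x hw
  obtain ⟨hcf, -⟩ := h.fork_out f (by simp [hf])
  obtain ⟨r, hr⟩ := Option.ne_none_iff_exists'.1 hcf
  have hxr : x ≠ r := by
    rintro rfl
    exact h.right_child_in f x w (by simp [hf]) hr hw
  obtain ⟨hst, hd⟩ := hs.2 f s r w x hf hr hsw hw
  have hfr : G.Descendant f r := .single (Or.inl hr)
  refine ⟨f, s, r, hf, hr, hsw, ?_, hxr⟩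
  rcases hst with h1 | h1
  · refine h1.cont_of_ne ?_ hr
    rintro rfl
    exact h.acyclic _ (hfr.trans hd)
  · rcases h1.eq_or_descendant with rfl | h1
    · exact absurd (hfr.trans hd) (h.acyclic _)
    · exact absurd ((hfr.trans hd).trans h1) (h.acyclic _)

theorem follows_of_touch (h : G.IsComputationDag) (hs : G.IsStructuredLocalTouch) {w x f s r : V}
    (hw : G.touch w = some x) (hf : G.future f = some s) (hr : G.cont f = some r)
    (hsw : G.Follows s w) : G.Follows r x ∧ x ≠ r := by
  obtain ⟨f', s', r', hf', hr', hsw', hrx, hx⟩ := exists_fork_of_touch h hs hw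
  obtain rfl := h.fork_unique hf hf' hsw hsw'
  rw [hr] at hr'
  cases hr'
  exact ⟨hrx, hx⟩

/-- There is a directed path with `n` edges that ends at `v`. -/
def HasPath (G : FutureGraph V) (n : ℕ) (v : V) : Prop :=
  ∃ π : Fin (n + 1) → V, (∀ i : Fin n, G.Edge (π i.castSucc) (π i.succ)) ∧ π (Fin.last n) = v

theorem HasPath.zero (G : FutureGraph V) (v : V) : G.HasPath 0 v :=
  ⟨fun _ => v, fun i => i.elim0, rfl⟩

theorem HasPath.succ {n : ℕ} {v w : V} (hp : G.HasPath n v) (e : G.Edge v w) :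
    G.HasPath (n + 1) w := by
  obtain ⟨π, hπ, rfl⟩ := hp
  refine ⟨Fin.snoc π w, fun i => ?_, by simp⟩
  induction i using Fin.lastCases with
  | last =>
    rw [Fin.succ_last, Fin.snoc_last, Fin.snoc_castSucc]
    exact e
  | cast i =>
    rw [Fin.succ_castSucc, Fin.snoc_castSucc, Fin.snoc_castSucc]
    exact hπ i

theorem HasPath.le_span [Finite V] (h : G.IsComputationDag) {n : ℕ} {v : V}
    (hp : G.HasPath n v) : n ≤ G.span := by
  have := Fintype.ofFinite V
  refine le_csSup ⟨Fintype.card V, ?_⟩ ⟨hp.choose, hp.choose_spec.1⟩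
  rintro m ⟨π, hπ⟩
  have hlt : ∀ i j : Fin (m + 1), i < j → G.Descendant (π i) (π j) := by
    intro i j hij
    induction j using Fin.induction with
    | zero => exact absurd hij (Fin.not_lt_zero i)
    | succ j ih =>
      rcases (Fin.le_castSucc_iff.2 hij).lt_or_eq with h' | h'
      · exact (ih h').tail (hπ j)
      · rw [h']; exact .single (hπ j)
  have hinj : Function.Injective π := by
    intro i j hij
    rcases lt_trichotomy i j with h' | h' | h'
    · exact absurd (hij ▸ hlt i j h') (h.acyclic _)
    · exact h'
    · exact absurd (hij ▸ hlt j i h') (h.acyclic _)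
  have := Fintype.card_le_of_injective π hinj
  simp at this
  omega

/-- Along edges, some natural number strictly increases. -/
theorem exists_rank [Finite V] (h : G.IsComputationDag) :
    ∃ rk : V → ℕ, ∀ u v, G.Edge u v → rk u < rk v := by
  refine ⟨fun v => {u | G.Descendant u v}.ncard, fun u v e => ?_⟩
  refine Set.ncard_lt_ncard ⟨fun a ha => TransGen.tail ha e, fun hsub => ?_⟩ (Set.toFinite _)
  exact h.acyclic u (hsub (TransGen.single e))

/-- The nesting depth of threads. -/
theorem exists_depth [Finite V] (h : G.IsComputationDag) :
    ∃ dp : V → ℕ, (∀ u v, G.cont u = some v → dp v = dp u) ∧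
      (∀ u v, G.future u = some v → dp v = dp u + 1) ∧ ∀ v, dp v ≤ G.span := by
  classical
  obtain ⟨rk, hrk⟩ := exists_rank h
  have ex : ∀ n, ∃ dp : V → ℕ, (∀ u v, rk v < n → G.cont u = some v → dp v = dp u) ∧
      (∀ u v, rk v < n → G.future u = some v → dp v = dp u + 1) ∧
      ∀ v, rk v < n → ∃ m, dp v ≤ m ∧ G.HasPath m v := by
    intro n
    induction n with
    | zero => exact ⟨fun _ => 0, by simp, by simp, by simp⟩
    | succ n ih =>
      obtain ⟨dp, h1, h2, h3⟩ := ih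
      let nd : V → ℕ := fun v =>
        if rk v < n then dp v
        else if hc : ∃ u, G.cont u = some v then dp hc.choose
        else if hf : ∃ u, G.future u = some v then dp hf.choose + 1 else 0
      have nd_lt : ∀ v, rk v < n → nd v = dp v := fun v hv => by simp [nd, hv]
      refine ⟨nd, fun u v hv hc => ?_, fun u v hv hf => ?_, fun v hv => ?_⟩
      · have hu := hrk u v (Or.inl hc)
        rw [nd_lt u (by omega)]
        by_cases hv' : rk v < n
        · rw [nd_lt v hv', h1 u v hv' hc]
        · have hex : ∃ u, G.cont u = some v := ⟨u, hc⟩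
          simp only [nd, hv', if_false, dif_pos hex]
          rw [h.cont_inj _ _ _ hex.choose_spec hc]
      · have hu := hrk u v (Or.inr (Or.inl hf))
        rw [nd_lt u (by omega)]
        by_cases hv' : rk v < n
        · rw [nd_lt v hv', h2 u v hv' hf]
        · have hnc : ¬ ∃ u, G.cont u = some v := fun ⟨w, hw⟩ => (h.left_child_in u v w hf).1 hw
          have hex : ∃ u, G.future u = some v := ⟨u, hf⟩
          simp only [nd, hv', if_false, dif_neg hnc, dif_pos hex]
          rw [h.future_inj _ _ _ hex.choose_spec hf]
      · by_cases hv' : rk v < n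
        · rw [nd_lt v hv']; exact h3 v hv'
        · by_cases hc : ∃ u, G.cont u = some v
          · have e := hc.choose_spec
            obtain ⟨m, hm, hp⟩ := h3 hc.choose (by have := hrk _ _ (Or.inl e); omega)
            refine ⟨m + 1, ?_, hp.succ (Or.inl e)⟩
            simp only [nd, hv', if_false, dif_pos hc]
            omega
          · by_cases hf : ∃ u, G.future u = some v
            · have e := hf.choose_spec
              obtain ⟨m, hm, hp⟩ := h3 hf.choose (by have := hrk _ _ (Or.inr (Or.inl e)); omega)
              refine ⟨m + 1, ?_, hp.succ (Or.inr (Or.inl e))⟩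
              simp only [nd, hv', if_false, dif_neg hc, dif_pos hf]
              omega
            · exact ⟨0, by simp [nd, hv', hc, hf], HasPath.zero G v⟩
  have := Fintype.ofFinite V
  obtain ⟨dp, h1, h2, h3⟩ := ex (Finset.univ.sup rk + 1)
  have hb : ∀ v, rk v < Finset.univ.sup rk + 1 := fun v =>
    Nat.lt_succ_of_le (Finset.le_sup (Finset.mem_univ v))
  refine ⟨dp, fun u v => h1 u v (hb v), fun u v => h2 u v (hb v), fun v => ?_⟩
  obtain ⟨m, hm, hp⟩ := h3 v (hb v)
  exact hm.trans (hp.le_span h)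

end Graph

end FutureGraph

/-! ### Invariants of executions -/

namespace FutureGraph

section Execution

variable {V : Type*} {G : FutureGraph V} {P : ℕ}

/-- The nodes that processor `p` holds: its current node followed by its deque, from bottom to
top. -/
def stack (s : WSState V P) (p : Fin P) : List V := (s.current p).toList ++ s.deque p

/-- The node `v` has been executed. -/
def Executed (s : WSState V P) (v : V) : Prop := ∃ p, v ∈ s.trace p

/-- All parents of `v` have been executed. -/
def Ready (G : FutureGraph V) (s : WSState V P) (v : V) : Prop := ∀ u, G.Edge u v → Executed s u

variable [DecidableEq V]

/-- The number of times that `v` occurs among the executed nodes, current nodes and deques. -/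
def occ (s : WSState V P) (v : V) : ℕ := ∑ p, ((s.trace p).count v + (stack s p).count v)

open Classical in
/-- The basic invariant of executions: processors without a current node have an empty deque, and
a node occurs, exactly once, as soon as all its parents have been executed. -/
structure Inv (G : FutureGraph V) (s : WSState V P) : Prop where
  idle : ∀ p, s.current p = none → s.deque p = []
  occ_eq : ∀ v, occ s v = if G.Ready s v then 1 else 0

theorem one_le_occ_of_mem_trace {s : WSState V P} {v : V} {p : Fin P} (hv : v ∈ s.trace p) :
    1 ≤ occ s v := by
  have h1 : 0 < (s.trace p).count v := List.count_pos_iff.2 hv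
  refine le_trans ?_ (Finset.single_le_sum (fun _ _ => Nat.zero_le _) (Finset.mem_univ p))
  omega

theorem one_le_occ_of_mem_stack {s : WSState V P} {v : V} {p : Fin P} (hv : v ∈ stack s p) :
    1 ≤ occ s v := by
  have h1 : 0 < (stack s p).count v := List.count_pos_iff.2 hv
  refine le_trans ?_ (Finset.single_le_sum (fun _ _ => Nat.zero_le _) (Finset.mem_univ p))
  omega

namespace Inv

variable {s : WSState V P}

theorem occ_le_one (i : G.Inv s) (v : V) : occ s v ≤ 1 := by
  rw [i.occ_eq]; split_ifs <;> simp

theorem ready_of_mem_trace (i : G.Inv s) {v : V} {p : Fin P} (hv : v ∈ s.trace p) :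
    G.Ready s v := by
  by_contra hn
  have := one_le_occ_of_mem_trace hv
  rw [i.occ_eq, if_neg hn] at this
  omega

theorem ready_of_executed (i : G.Inv s) {v : V} (hv : Executed s v) : G.Ready s v :=
  i.ready_of_mem_trace hv.choose_spec

theorem ready_of_mem_stack (i : G.Inv s) {v : V} {p : Fin P} (hv : v ∈ stack s p) :
    G.Ready s v := by
  by_contra hn
  have := one_le_occ_of_mem_stack hv
  rw [i.occ_eq, if_neg hn] at this
  omega

theorem executed_or_mem_stack (i : G.Inv s) {v : V} (hv : G.Ready s v) :
    Executed s v ∨ ∃ p, v ∈ stack s p := by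
  have h1 : occ s v ≠ 0 := by rw [i.occ_eq, if_pos hv]; simp
  obtain ⟨p, -, hp⟩ := Finset.exists_ne_zero_of_sum_ne_zero h1
  by_cases h2 : v ∈ s.trace p
  · exact Or.inl ⟨p, h2⟩
  · refine Or.inr ⟨p, List.count_pos_iff.1 ?_⟩
    rw [List.count_eq_zero_of_not_mem h2] at hp
    omega

theorem sum_two_le (i : G.Inv s) (v : V) {p q : Fin P} (hpq : p ≠ q) :
    ((s.trace p).count v + (stack s p).count v) + ((s.trace q).count v + (stack s q).count v)
      ≤ 1 := by
  rw [← Finset.sum_pair (f := fun p => (s.trace p).count v + (stack s p).count v) hpq]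
  exact le_trans (Finset.sum_le_sum_of_subset (Finset.subset_univ _)) (i.occ_le_one v)

theorem count_le (i : G.Inv s) (v : V) (p : Fin P) :
    (s.trace p).count v + (stack s p).count v ≤ 1 :=
  le_trans (Finset.single_le_sum (f := fun p => (s.trace p).count v + (stack s p).count v)
    (fun _ _ => Nat.zero_le _) (Finset.mem_univ p)) (i.occ_le_one v)

theorem not_executed_of_mem_stack (i : G.Inv s) {v : V} {p : Fin P} (hv : v ∈ stack s p) :
    ¬ Executed s v := by
  rintro ⟨q, hq⟩
  have h1 := List.count_pos_iff.2 hv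
  have h2 := List.count_pos_iff.2 hq
  by_cases hpq : p = q
  · subst hpq
    have := i.count_le v p
    omega
  · have := i.sum_two_le v hpq
    omega

theorem trace_unique (i : G.Inv s) {v : V} {p q : Fin P} (hp : v ∈ s.trace p)
    (hq : v ∈ s.trace q) : p = q := by
  by_contra hpq
  have h1 := List.count_pos_iff.2 hp
  have h2 := List.count_pos_iff.2 hq
  have := i.sum_two_le v hpq
  omega

theorem nodup_trace (i : G.Inv s) (p : Fin P) : (s.trace p).Nodup :=
  List.nodup_iff_count_le_one.2 fun v => by have := i.count_le v p; omega

theorem nodup_stack (i : G.Inv s) (p : Fin P) : (stack s p).Nodup :=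
  List.nodup_iff_count_le_one.2 fun v => by have := i.count_le v p; omega

theorem stack_unique (i : G.Inv s) {v : V} {p q : Fin P} (hp : v ∈ stack s p)
    (hq : v ∈ stack s q) : p = q := by
  by_contra hpq
  have h1 := List.count_pos_iff.2 hp
  have h2 := List.count_pos_iff.2 hq
  have := i.sum_two_le v hpq
  omega

theorem executed_of_descendant (i : G.Inv s) {u v : V} (h : G.Descendant u v)
    (hv : Executed s v) : Executed s u := by
  induction h with
  | single e => exact i.ready_of_executed hv _ e
  | tail _ e ih => exact ih (i.ready_of_executed hv _ e)

theorem executed_of_follows (i : G.Inv s) {u v : V} (h : G.Follows u v)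
    (hv : Executed s v) : Executed s u := by
  rcases h.eq_or_descendant with rfl | h
  · exact hv
  · exact i.executed_of_descendant h hv

end Inv

variable [Fintype V]

theorem mem_enabled {s : WSState V P} {v w : V} :
    w ∈ G.enabled s v ↔ G.Edge v w ∧ G.Ready s w := by
  simp only [enabled, List.mem_filter, List.mem_append, Option.mem_toList,
    decide_eq_true_eq, Edge, Ready, Executed]
  tauto

/-- The nodes enabled by `v`, when `v` is a fork. -/
theorem enabled_fork (h : G.IsComputationDag) {s : WSState V P} {v a : V} (hv : Executed s v)
    (ha : G.future v = some a) :
    ∃ b, G.cont v = some b ∧ G.enabled s v = [a, b] := by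
  obtain ⟨hc, ht⟩ := h.fork_out v (by simp [ha])
  obtain ⟨b, hb⟩ := Option.ne_none_iff_exists'.1 hc
  refine ⟨b, hb, ?_⟩
  have h1 : ∀ u, G.Edge u a → Executed s u := by
    rintro u (e | e | e)
    · exact absurd e (h.left_child_in v a u ha).1
    · rwa [h.future_inj u v a e ha]
    · exact absurd e (h.left_child_in v a u ha).2
  have h2 : ∀ u, G.Edge u b → Executed s u := by
    rintro u (e | e | e)
    · rwa [h.cont_inj u v b e hb]
    · exact absurd hb (h.left_child_in u b v e).1
    · exact absurd e (h.right_child_in v b u (by simp [ha]) hb)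
  unfold enabled
  rw [List.filter_eq_self.2]
  · simp [ha, hb, ht]
  · intro w hw
    simp only [ha, hb, ht, Option.toList_some, Option.toList_none, List.append_nil,
      List.cons_append, List.nil_append, List.mem_cons, List.not_mem_nil, or_false] at hw
    simp only [decide_eq_true_eq]
    rcases hw with rfl | rfl
    · exact h1
    · exact h2

theorem nodup_enabled (h : G.IsComputationDag) (s : WSState V P) (v : V) :
    (G.enabled s v).Nodup := by
  refine List.Nodup.filter _ ?_
  cases hf : G.future v with
  | some a =>
    obtain ⟨hc, ht⟩ := h.fork_out v (by simp [hf])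
    obtain ⟨b, hb⟩ := Option.ne_none_iff_exists'.1 hc
    have : a ≠ b := by
      rintro rfl
      exact (h.left_child_in v a v hf).1 hb
    simp [hb, ht, this]
  | none =>
    cases hc : G.cont v with
    | none => cases ht : G.touch v <;> simp
    | some b =>
      cases ht : G.touch v with
      | none => simp
      | some x =>
        have : b ≠ x := by
          rintro rfl
          exact h.touch_ne_cont ht hc
        simp [this]

/-- The nodes enabled by `v`, when `v` is not a fork. -/
theorem enabled_nonfork {s : WSState V P} {v : V} (hv : G.future v = none) :
    (G.enabled s v = []) ∨ (∃ b, G.cont v = some b ∧ G.Ready s b ∧ G.enabled s v = [b]) ∨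
    (∃ x, G.touch v = some x ∧ G.Ready s x ∧ G.enabled s v = [x] ∧
      ∀ b, G.cont v = some b → ¬ G.Ready s b) ∨
    (∃ b x, G.cont v = some b ∧ G.touch v = some x ∧ G.Ready s b ∧ G.Ready s x ∧
      G.enabled s v = [b, x]) := by
  have hd : ∀ w : V, (decide (∀ u, G.Edge u w → ∃ p, u ∈ s.trace p) = true) ↔ G.Ready s w :=
    fun w => by rw [decide_eq_true_eq]; rfl
  cases hc : G.cont v with
  | none =>
    cases ht : G.touch v with
    | none => left; simp [enabled, hv, hc, ht]
    | some x =>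
      by_cases hx : G.Ready s x
      · right; right; left
        refine ⟨x, rfl, hx, ?_, by simp⟩
        unfold enabled
        rw [List.filter_eq_self.2 (by intro w hw; rw [hd]; simp [hv, hc, ht] at hw; rwa [hw])]
        simp [hv, hc, ht]
      · left
        unfold enabled
        rw [List.filter_eq_nil_iff]
        intro w hw
        rw [hd]; simp [hv, hc, ht] at hw; rwa [hw]
  | some b =>
    cases ht : G.touch v with
    | none =>
      by_cases hb : G.Ready s b
      · right; left
        refine ⟨b, rfl, hb, ?_⟩
        unfold enabled
        rw [List.filter_eq_self.2 (by intro w hw; rw [hd]; simp [hv, hc, ht] at hw; rwa [hw])]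
        simp [hv, hc, ht]
      · left
        unfold enabled
        rw [List.filter_eq_nil_iff]
        intro w hw
        rw [hd]; simp [hv, hc, ht] at hw; rwa [hw]
    | some x =>
      obtain ⟨e, hd, hE⟩ : ∃ e : V → Bool, (∀ w, e w = true ↔ G.Ready s w) ∧
          G.enabled s v = [b, x].filter e :=
        ⟨_, hd, by unfold enabled; simp [hv, hc, ht]⟩
      by_cases hb : G.Ready s b <;> by_cases hx : G.Ready s x
      · right; right; right
        refine ⟨b, x, rfl, rfl, hb, hx, ?_⟩
        rw [hE, List.filter_cons_of_pos ((hd b).2 hb), List.filter_cons_of_pos ((hd x).2 hx),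
          List.filter_nil]
      · right; left
        refine ⟨b, rfl, hb, ?_⟩
        rw [hE, List.filter_cons_of_pos ((hd b).2 hb), List.filter_cons_of_neg (by rwa [hd x]),
          List.filter_nil]
      · right; right; left
        refine ⟨x, rfl, hx, ?_, ?_⟩
        · rw [hE, List.filter_cons_of_neg (by rwa [hd b]), List.filter_cons_of_pos ((hd x).2 hx),
            List.filter_nil]
        · rintro b' hb'
          cases hb'
          exact hb
      · left
        rw [hE, List.filter_cons_of_neg (by rwa [hd b]), List.filter_cons_of_neg (by rwa [hd x]),
          List.filter_nil]

/-- The possible effects of a step of processor `p` with victim `q`, in terms of `stack`. -/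
inductive StepSpec (G : FutureGraph V) (s s' : WSState V P) (p q : Fin P) : Prop
  | exec (v : V) (R : List V) (hc : s.current p = some v) (hs : stack s p = v :: R)
      (ht : s'.trace = Function.update s.trace p (s.trace p ++ [v]))
      (hs' : stack s' = Function.update (stack s) p (G.enabled s' v ++ R))
  | idle (hc : s.current p = none) (hq : s.deque q = []) (he : s' = s)
  | steal (w : V) (S : List V) (hc : s.current p = none) (hq : (s.deque q).getLast? = some w)
      (hpq : p ≠ q) (hp : stack s p = []) (hS : S ≠ []) (hs : stack s q = S ++ [w])
      (ht : s'.trace = s.trace)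
      (hs' : stack s' = Function.update (Function.update (stack s) q S) p [w])

theorem stepSpec_and_idle {s : WSState V P} (hi : ∀ p, s.current p = none → s.deque p = [])
    (p q : Fin P) : StepSpec G s (G.wsStep s p q) p q ∧
      ∀ p', (G.wsStep s p q).current p' = none → (G.wsStep s p q).deque p' = [] := by
  unfold wsStep
  cases hc : s.current p with
  | some v =>
    have key : ∀ d : List V, d.head?.toList ++ d.tail = d := fun d => by cases d <;> simp
    refine ⟨.exec v (s.deque p) hc (by simp [stack, hc]) rfl ?_, ?_⟩
    · funext p'
      by_cases hp : p' = p
      · subst hp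
        simp only [stack, execStep, Function.update_self]
        rw [key]; rfl
      · simp [stack, execStep, Function.update_of_ne hp]
    · intro p'
      by_cases hp : p' = p
      · subst hp
        simp only [execStep, Function.update_self]
        intro h
        rw [List.head?_eq_none_iff] at h
        rw [h]; rfl
      · simp only [execStep, Function.update_of_ne hp]
        exact hi p'
  | none =>
    simp only [stealStep]
    cases hl : (s.deque q).getLast? with
    | none =>
      rw [List.getLast?_eq_none_iff] at hl
      exact ⟨.idle hc hl rfl, hi⟩
    | some w =>
      obtain ⟨D, hD⟩ := List.getLast?_eq_some_iff.1 hl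
      have hpq : p ≠ q := by
        rintro rfl
        rw [hi p hc] at hD
        simp at hD
      have hcq : s.current q ≠ none := fun h => by
        rw [hi q h] at hD
        simp at hD
      obtain ⟨u, hu⟩ := Option.ne_none_iff_exists'.1 hcq
      refine ⟨.steal w (u :: D) hc hl hpq (by simp [stack, hc, hi p hc]) (by simp)
        (by simp [stack, hu, hD]) rfl ?_, ?_⟩
      · funext p'
        by_cases hp : p' = p
        · subst hp
          simp [stack, Function.update_of_ne hpq, hi p' hc]
        · by_cases hq : p' = q
          · subst hq
            simp [stack, Function.update_of_ne hp, hu, hD]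
          · simp [stack, Function.update_of_ne hp, Function.update_of_ne hq]
      · intro p'
        by_cases hp : p' = p
        · subst hp; simp
        · simp only [Function.update_of_ne hp]
          intro h
          by_cases hq : p' = q
          · subst hq; exact absurd h hcq
          · rw [Function.update_of_ne hq]; exact hi p' h

omit [DecidableEq V] [Fintype V] in
theorem executed_update {s s' : WSState V P} {p : Fin P} {v : V}
    (ht : s'.trace = Function.update s.trace p (s.trace p ++ [v])) (w : V) :
    Executed s' w ↔ Executed s w ∨ w = v := by
  unfold Executed
  rw [ht]
  constructor
  · rintro ⟨p', hp'⟩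
    by_cases hp : p' = p
    · subst hp
      rw [Function.update_self, List.mem_append, List.mem_singleton] at hp'
      exact hp'.imp (fun h => ⟨_, h⟩) id
    · rw [Function.update_of_ne hp] at hp'
      exact Or.inl ⟨_, hp'⟩
  · rintro (⟨p', hp'⟩ | rfl)
    · by_cases hp : p' = p
      · subst hp
        exact ⟨p', by simp [hp']⟩
      · exact ⟨p', by rwa [Function.update_of_ne hp]⟩
    · exact ⟨p, by simp⟩

theorem Inv.step (h : G.IsComputationDag) {s : WSState V P} (i : G.Inv s) (p q : Fin P) :
    G.Inv (G.wsStep s p q) := by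
  obtain ⟨hsp, hid⟩ := stepSpec_and_idle (G := G) i.idle p q
  generalize G.wsStep s p q = s' at hsp hid
  refine ⟨hid, fun w => ?_⟩
  cases hsp with
  | idle hc hq he => rw [he]; exact i.occ_eq w
  | steal x S hc hq hpq hp hS hs ht hs' =>
    have hR : G.Ready s' w ↔ G.Ready s w := by unfold Ready Executed; rw [ht]
    rw [propext hR, ← i.occ_eq w]
    unfold occ
    rw [ht, hs', Finset.sum_add_distrib, Finset.sum_add_distrib]
    congr 1
    rw [← Finset.add_sum_erase _ _ (Finset.mem_univ p),
      ← Finset.add_sum_erase _ (fun p => (stack s p).count w) (Finset.mem_univ p),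
      ← Finset.add_sum_erase _ _ (Finset.mem_erase.2 ⟨hpq.symm, Finset.mem_univ q⟩),
      ← Finset.add_sum_erase _ (fun p => (stack s p).count w)
        (Finset.mem_erase.2 ⟨hpq.symm, Finset.mem_univ q⟩)]
    rw [Finset.sum_congr rfl (g := fun p => (stack s p).count w)]
    · simp only [Function.update_self, Function.update_of_ne hpq.symm, hp, hs, List.count_append,
        List.count_nil]
      omega
    · intro a ha
      simp only [Finset.mem_erase, Finset.mem_univ, and_true] at ha
      rw [Function.update_of_ne ha.2, Function.update_of_ne ha.1]
  | exec v R hc hs ht hs' =>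
    have hmem : v ∈ stack s p := by simp [hs]
    have hnv : ¬ Executed s v := i.not_executed_of_mem_stack hmem
    have hocc : occ s' w = occ s w + (G.enabled s' v).count w := by
      unfold occ
      rw [ht, hs', ← Finset.add_sum_erase _ _ (Finset.mem_univ p),
        ← Finset.add_sum_erase _ (fun p => (s.trace p).count w + (stack s p).count w)
          (Finset.mem_univ p)]
      rw [Finset.sum_congr rfl (g := fun p => (s.trace p).count w + (stack s p).count w)]
      · simp only [Function.update_self, hs, List.count_append, List.count_cons, List.count_nil]
        omega
      · intro a ha
        simp only [Finset.mem_erase, Finset.mem_univ, and_true] at ha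
        rw [Function.update_of_ne ha, Function.update_of_ne ha]
    have hex := executed_update ht
    rw [hocc, i.occ_eq w]
    by_cases he : G.Edge v w
    · have h1 : ¬ G.Ready s w := fun hr => hnv (hr v he)
      rw [if_neg h1, zero_add]
      by_cases h2 : G.Ready s' w
      · rw [if_pos h2]
        exact List.count_eq_one_of_mem (nodup_enabled h _ _) (mem_enabled.2 ⟨he, h2⟩)
      · rw [if_neg h2]
        exact List.count_eq_zero_of_not_mem fun h3 => h2 (mem_enabled.1 h3).2
    · rw [List.count_eq_zero_of_not_mem fun h3 => he (mem_enabled.1 h3).1, add_zero]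
      have : G.Ready s' w ↔ G.Ready s w := by
        refine forall_congr' fun u => imp_congr_right fun e => ?_
        rw [hex]
        refine or_iff_left ?_
        rintro rfl
        exact he e
      rw [propext this]

omit [Fintype V] in
theorem inv_initState (h : G.IsComputationDag) (p₀ : Fin P) : G.Inv (G.initState p₀) := by
  refine ⟨fun _ _ => rfl, fun v => ?_⟩
  have h1 : occ (G.initState p₀) v = if v = G.root then 1 else 0 := by
    unfold occ
    rw [← Finset.add_sum_erase _ _ (Finset.mem_univ p₀), Finset.sum_eq_zero]
    · simp only [initState, stack, Function.update_self, Option.toList_some, List.count_nil,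
        List.append_nil, List.count_cons, zero_add, add_zero, beq_iff_eq]
      simp only [eq_comm]
    · intro a ha
      simp only [Finset.mem_erase, Finset.mem_univ, and_true] at ha
      simp [initState, stack, Function.update_of_ne ha]
  rw [h1]
  by_cases hv : v = G.root
  · subst hv
    rw [if_pos rfl, if_pos (show G.Ready _ _ from fun u e => absurd e (h.root_in u))]
  · rw [if_neg hv, if_neg]
    intro hr
    have : ∃ u, G.Edge u v := by
      rcases h.exists_in v hv with ⟨u, hu⟩ | ⟨u, hu⟩
      · exact ⟨u, Or.inl hu⟩
      · exact ⟨u, Or.inr (Or.inl hu)⟩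
    obtain ⟨u, e⟩ := this
    obtain ⟨p, hp⟩ := hr u e
    simp [initState] at hp

end Execution

end FutureGraph

/-! ### How a node comes to be executed -/

namespace FutureGraph

section Origin

variable {V : Type*} {G : FutureGraph V} {P : ℕ}

/-- The node `y` may lie in a deque while its processor executes the thread from `c` on: either
`c` and `y` are the two children of a fork, or `y` is touched by the node before `c`. -/
def Sibling (G : FutureGraph V) (c y : V) : Prop :=
  (∃ f, G.cont f = some y ∧ G.future f = some c) ∨ ∃ w, G.touch w = some y ∧ G.cont w = some c

/-- The relation between consecutive nodes `u`, `y` of a stack, the first being nearer to the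
bottom of the deque: the processor has advanced from the sibling of `y` to `u`. -/
def Linked (G : FutureGraph V) (u y : V) : Prop := ∃ c, G.Sibling c y ∧ G.Follows c u

/-- The node `x` is executed, or about to be executed, by the processor that executed `y`, right
after `y`. -/
def ImmediatelyAfter (s : WSState V P) (y x : V) : Prop :=
  ∃ p, ((stack s p).head? = some x ∧ ∃ T, s.trace p = T ++ [y]) ∨ [y, x] <:+: s.trace p

/-- At some time up to `n` the local parent of the touch `x` had been executed, but not the node of
the future thread that touches `x`. -/
def Blocked (G : FutureGraph V) (s : ℕ → WSState V P) (n : ℕ) (x : V) : Prop :=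
  ∃ l w, G.cont l = some x ∧ G.touch w = some x ∧
    ∃ m, m ≤ n ∧ Executed (s m) l ∧ ¬ Executed (s m) w

/-- The node `y` has been stolen before step `n`. -/
def Stolen (s : ℕ → WSState V P) (π ω : ℕ → Fin P) (n : ℕ) (y : V) : Prop :=
  ∃ m, m < n ∧ (s m).current (π m) = none ∧ ((s m).deque (ω m)).getLast? = some y

/-- How a node `y` other than the root came to be executed: right after the node that precedes it
in the sequential order (the first two cases), by theft, or from a deque, or as a
touch that had been blocked. In the last two cases, either the thread that `y` waited for had been
completed or a later node of that thread was blocked. -/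
inductive Origin (G : FutureGraph V) (s : ℕ → WSState V P) (π ω : ℕ → Fin P) (n : ℕ) (y : V) : Prop
  | left (v : V) (hv : G.future v = some y) (ha : ImmediatelyAfter (s n) v y)
  | next (v : V) (hv : G.cont v = some y) (hf : G.future v = none)
      (ha : ImmediatelyAfter (s n) v y) (hb : ¬ G.Blocked s n y)
  | stolen (hs : Stolen s π ω n y)
  | right (f c : V) (hf : G.cont f = some y) (hc : G.future f = some c)
      (ho : (∃ a, G.Follows c a ∧ G.Blocked s n a) ∨
        ∃ z, G.Follows c z ∧ G.cont z = none ∧ ImmediatelyAfter (s n) z y)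
  | touch (w : V) (hw : G.touch w = some y) (hb : G.Blocked s n y)
      (ho : (∃ a c, G.cont w = some c ∧ G.Follows c a ∧ G.Blocked s n a) ∨
        ∃ z, G.Follows w z ∧ G.cont z = none ∧ Executed (s n) z)

variable [DecidableEq V] [Fintype V]

/-- `s n` is the configuration after `n` steps of an execution whose step `k` is taken by processor
`π k` with victim `ω k`. -/
structure IsExecution (G : FutureGraph V) (p₀ : Fin P) (π ω : ℕ → Fin P)
    (s : ℕ → WSState V P) : Prop where
  zero : s 0 = G.initState p₀
  succ : ∀ n, s (n + 1) = G.wsStep (s n) (π n) (ω n)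

theorem isExecution_run (G : FutureGraph V) (p₀ : Fin P) (adv : Adversary P) (ω : ℕ → Fin P) :
    G.IsExecution p₀ (scheduled adv ω) ω (G.run p₀ adv ω) :=
  ⟨rfl, fun _ => rfl⟩

omit [Fintype V] in
theorem Inv.current_eq {s : WSState V P} (i : G.Inv s) (p : Fin P) :
    s.current p = (stack s p).head? := by
  unfold stack
  cases hc : s.current p with
  | none => simp [i.idle p hc]
  | some v => simp

omit [Fintype V] in
/-- While `y` waits in a deque and its processor executes the thread of the sibling of `y`, no
touch of that thread can be enabled. -/
theorem Linked.not_ready_touch (h : G.IsComputationDag) (hs : G.IsStructuredLocalTouch)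
    {s s' : WSState V P} (i : G.Inv s) {v y t : V} (hl : G.Linked v y) (hv : ¬ Executed s v)
    (hy : ¬ Executed s y) (hry : G.Ready s y) (hex : ∀ u, Executed s' u ↔ Executed s u ∨ u = v)
    (ht : G.touch v = some t) : ¬ G.Ready s' t := by
  intro hrt
  obtain ⟨l, hlt⟩ := h.exists_localParent ht
  have hlv : l ≠ v := by
    rintro rfl
    exact h.touch_ne_cont ht hlt
  have hexl : Executed s l := ((hex l).1 (hrt l (Or.inl hlt))).resolve_right hlv
  have key : G.Follows y t → y ≠ t → False := fun hyt hne =>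
    hy (i.executed_of_follows (h.follows_pred hyt hne hlt) hexl)
  obtain ⟨c, ⟨f, hfy, hfc⟩ | ⟨w, hwy, hwc⟩, hcv⟩ := hl
  · obtain ⟨h1, h2⟩ := follows_of_touch h hs ht hfc hfy hcv
    exact key h1 (Ne.symm h2)
  · obtain ⟨f, a, r, hfa, hfr, haw, hry', -⟩ := exists_fork_of_touch h hs hwy
    have hrt' := (follows_of_touch h hs ht hfa hfr ((haw.tail hwc).trans hcv)).1
    have hyt : y ≠ t := by
      rintro rfl
      obtain rfl := h.touch_inj _ _ _ hwy ht
      exact h.not_follows_of_cont hwc hcv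
    rcases hry'.total hrt' with h1 | h1
    · exact key h1 hyt
    · obtain ⟨l', hl'⟩ := h.exists_localParent hwy
      have : Executed s t :=
        i.executed_of_follows (h.follows_pred h1 hyt.symm hl') (hry l' (Or.inl hl'))
      exact hv (i.ready_of_executed this v (Or.inr (Or.inr ht)))

theorem chain_step (h : G.IsComputationDag) (hs : G.IsStructuredLocalTouch) {s : WSState V P}
    (i : G.Inv s) (hch : ∀ p, (stack s p).IsChain G.Linked) (p q p' : Fin P) :
    (stack (G.wsStep s p q) p').IsChain G.Linked := by
  obtain ⟨hsp, -⟩ := stepSpec_and_idle (G := G) i.idle p q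
  generalize G.wsStep s p q = s' at hsp
  cases hsp with
  | idle hc hq he => rw [he]; exact hch p'
  | steal x S hc hq hpq hp hS hst ht hs' =>
    rw [hs']
    by_cases h1 : p' = p
    · subst h1; simp
    · rw [Function.update_of_ne h1]
      by_cases h2 : p' = q
      · subst h2
        have := hch p'
        rw [hst] at this
        simpa using this.left_of_append
      · rw [Function.update_of_ne h2]; exact hch p'
  | exec v R hc hst ht hs' =>
    rw [hs']
    by_cases h1 : p' = p
    · subst h1
      rw [Function.update_self]
      have hex := executed_update ht
      have hch' := hch p'
      rw [hst] at hch'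
      have hvm : v ∈ stack s p' := by simp [hst]
      have hexv : Executed s' v := (hex v).2 (Or.inr rfl)
      have hlink : ∀ y ∈ R.head?, G.Linked v y ∧ ∀ t, G.touch v = some t → ¬ G.Ready s' t := by
        intro y hy
        obtain ⟨R', rfl⟩ : ∃ R', R = y :: R' := by
          cases R with
          | nil => simp at hy
          | cons a R' => simp at hy; subst hy; exact ⟨R', rfl⟩
        have hym : y ∈ stack s p' := by simp [hst]
        have hl : G.Linked v y := by simpa using hch'.rel
        exact ⟨hl, fun t ht' => hl.not_ready_touch h hs i (i.not_executed_of_mem_stack hvm)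
          (i.not_executed_of_mem_stack hym) (i.ready_of_mem_stack hym) hex ht'⟩
      have hcont : ∀ b, G.cont v = some b → ∀ y ∈ R.head?, G.Linked b y := by
        intro b hb y hy
        obtain ⟨⟨c, hc1, hc2⟩, -⟩ := hlink y hy
        exact ⟨c, hc1, hc2.tail hb⟩
      have hR : R.IsChain G.Linked := hch'.tail
      rw [List.isChain_append]
      cases hf : G.future v with
      | some a =>
        obtain ⟨b, hb, he⟩ := enabled_fork h hexv hf
        rw [he]
        refine ⟨?_, hR, ?_⟩
        · simp only [List.isChain_cons_cons, List.isChain_singleton, and_true]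
          exact ⟨a, Or.inl ⟨v, hb, hf⟩, Follows.refl G a⟩
        · simpa using hcont b hb
      | none =>
        rcases enabled_nonfork (s := s') hf with he | ⟨b, hb, -, he⟩ | ⟨x, hx, hrx, he, -⟩ |
          ⟨b, x, hb, hx, -, hrx, he⟩
        · rw [he]; exact ⟨by simp, hR, by simp⟩
        · rw [he]; exact ⟨by simp, hR, by simpa using hcont b hb⟩
        · rw [he]
          refine ⟨by simp, hR, fun _ _ y hy => absurd hrx ((hlink y hy).2 x hx)⟩
        · rw [he]
          refine ⟨?_, hR, fun _ _ y hy => absurd hrx ((hlink y hy).2 x hx)⟩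
          simp only [List.isChain_cons_cons, List.isChain_singleton, and_true]
          exact ⟨b, Or.inr ⟨v, hx, hb⟩, Follows.refl G b⟩
    · rw [Function.update_of_ne h1]; exact hch p'

namespace IsExecution

variable {p₀ : Fin P} {π ω : ℕ → Fin P} {s : ℕ → WSState V P}

theorem inv (hr : G.IsExecution p₀ π ω s) (h : G.IsComputationDag) (n : ℕ) : G.Inv (s n) := by
  induction n with
  | zero => rw [hr.zero]; exact inv_initState h p₀
  | succ n ih => rw [hr.succ]; exact ih.step h _ _

theorem stepSpec (hr : G.IsExecution p₀ π ω s) (h : G.IsComputationDag) (n : ℕ) :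
    StepSpec G (s n) (s (n + 1)) (π n) (ω n) := by
  rw [hr.succ]
  exact (stepSpec_and_idle (hr.inv h n).idle _ _).1

theorem chain (hr : G.IsExecution p₀ π ω s) (h : G.IsComputationDag)
    (hs : G.IsStructuredLocalTouch) (n : ℕ) (p : Fin P) :
    (stack (s n) p).IsChain G.Linked := by
  induction n generalizing p with
  | zero =>
    rw [hr.zero]
    by_cases hp : p = p₀
    · subst hp; simp [stack, initState]
    · simp [stack, initState, Function.update_of_ne hp]
  | succ n ih => rw [hr.succ]; exact chain_step h hs (hr.inv h n) ih _ _ _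

theorem executed_succ (hr : G.IsExecution p₀ π ω s) (h : G.IsComputationDag) {n : ℕ} {v : V} :
    Executed (s (n + 1)) v ↔ Executed (s n) v ∨ (s n).current (π n) = some v := by
  cases hr.stepSpec h n with
  | idle hc hq he => simp [he, hc]
  | steal x S hc hq hpq hp hS hst ht hs' =>
    unfold Executed
    simp [ht, hc]
  | exec w R hc hst ht hs' =>
    rw [executed_update ht, hc]
    simp [eq_comm]

theorem executed_mono (hr : G.IsExecution p₀ π ω s) (h : G.IsComputationDag) {m n : ℕ}
    (hmn : m ≤ n) {v : V} (hv : Executed (s m) v) : Executed (s n) v := by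
  induction n, hmn using Nat.le_induction with
  | base => exact hv
  | succ n _ ih => exact (hr.executed_succ h).2 (Or.inl ih)

end IsExecution

omit [DecidableEq V] [Fintype V] in
theorem Blocked.mono {s : ℕ → WSState V P} {m n : ℕ} {x : V} (hb : G.Blocked s m x)
    (hmn : m ≤ n) : G.Blocked s n x := by
  obtain ⟨l, w, h1, h2, k, hk, h3⟩ := hb
  exact ⟨l, w, h1, h2, k, hk.trans hmn, h3⟩

omit [DecidableEq V] [Fintype V] in
theorem Stolen.mono {s : ℕ → WSState V P} {π ω : ℕ → Fin P} {m n : ℕ} {x : V}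
    (hb : Stolen s π ω m x) (hmn : m ≤ n) : Stolen s π ω n x := by
  obtain ⟨k, hk, h3⟩ := hb
  exact ⟨k, by omega, h3⟩

namespace IsExecution

variable {p₀ : Fin P} {π ω : ℕ → Fin P} {s : ℕ → WSState V P}

/-- A touch is never blocked after all its parents have been executed. -/
theorem blocked_of_ready (hr : G.IsExecution p₀ π ω s) (h : G.IsComputationDag) {m n : ℕ} {x : V}
    (hx : G.Ready (s m) x) (hb : G.Blocked s n x) : G.Blocked s m x := by
  obtain ⟨l, w, h1, h2, k, hk, h3, h4⟩ := hb
  refine ⟨l, w, h1, h2, k, ?_, h3, h4⟩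
  by_contra hkm
  exact h4 (hr.executed_mono h (by omega) (hx w (Or.inr (Or.inr h2))))

theorem immediatelyAfter_succ (hr : G.IsExecution p₀ π ω s) (h : G.IsComputationDag) {n : ℕ}
    {y x : V} (ha : ImmediatelyAfter (s n) y x) : ImmediatelyAfter (s (n + 1)) y x := by
  obtain ⟨p, ⟨hp, T, hT⟩ | hp⟩ := ha
  · refine ⟨p, ?_⟩
    cases hr.stepSpec h n with
    | idle hc hq he => rw [he]; exact Or.inl ⟨hp, T, hT⟩
    | steal w S hc hq hpq hpe hS hst ht hs' =>
      refine Or.inl ⟨?_, T, by rw [ht, hT]⟩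
      have h1 : p ≠ π n := by
        rintro rfl
        rw [hpe] at hp; simp at hp
      rw [hs', Function.update_of_ne h1]
      by_cases h2 : p = ω n
      · subst h2
        rw [hst, List.head?_append_of_ne_nil _ hS] at hp
        rw [Function.update_self, hp]
      · rw [Function.update_of_ne h2, hp]
    | exec w R hc hst ht hs' =>
      by_cases h1 : p = π n
      · subst h1
        rw [hst] at hp
        simp at hp
        subst hp
        right
        rw [ht, Function.update_self, hT]
        exact ⟨T, [], by simp⟩
      · left
        rw [hs', ht, Function.update_of_ne h1, Function.update_of_ne h1]
        exact ⟨hp, T, hT⟩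
  · refine ⟨p, Or.inr ?_⟩
    cases hr.stepSpec h n with
    | idle hc hq he => rw [he]; exact hp
    | steal w S hc hq hpq hpe hS hst ht hs' => rw [ht]; exact hp
    | exec w R hc hst ht hs' =>
      rw [ht]
      by_cases h1 : p = π n
      · subst h1
        rw [Function.update_self]
        exact hp.trans (List.infix_append' [] _ _)
      · rwa [Function.update_of_ne h1]

theorem origin_succ (hr : G.IsExecution p₀ π ω s) (h : G.IsComputationDag) {n : ℕ} {y : V}
    (hy : G.Ready (s n) y) (ho : Origin G s π ω n y) : Origin G s π ω (n + 1) y := by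
  have hle := Nat.le_succ n
  cases ho with
  | left v hv ha => exact .left v hv (hr.immediatelyAfter_succ h ha)
  | next v hv hf ha hb =>
    exact .next v hv hf (hr.immediatelyAfter_succ h ha) fun hb' => hb (hr.blocked_of_ready h hy hb')
  | stolen hs => exact .stolen (hs.mono hle)
  | right f c hf hc ho =>
    refine .right f c hf hc ?_
    rcases ho with ⟨a, h1, h2⟩ | ⟨z, h1, h2, h3⟩
    · exact Or.inl ⟨a, h1, h2.mono hle⟩
    · exact Or.inr ⟨z, h1, h2, hr.immediatelyAfter_succ h h3⟩
  | touch w hw hb ho =>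
    refine .touch w hw (hb.mono hle) ?_
    rcases ho with ⟨a, c, h0, h1, h2⟩ | ⟨z, h1, h2, h3⟩
    · exact Or.inl ⟨a, c, h0, h1, h2.mono hle⟩
    · exact Or.inr ⟨z, h1, h2, hr.executed_mono h hle h3⟩

omit [DecidableEq V] [Fintype V] in
theorem blocked_of_not_ready (h : G.IsComputationDag) {n : ℕ} {v b : V}
    (hv : Executed (s n) v) (hb : G.cont v = some b) (hn : ¬ G.Ready (s n) b) :
    G.Blocked s n b := by
  unfold Ready at hn
  push Not at hn
  obtain ⟨u, e | e | e, hu⟩ := hn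
  · rw [h.cont_inj u v b e hb] at hu
    exact absurd hv hu
  · exact absurd hb (h.left_child_in u b v e).1
  · exact ⟨v, u, hb, e, n, le_rfl, hv, hu⟩

theorem blocked_of_touch (hr : G.IsExecution p₀ π ω s) (h : G.IsComputationDag) {n : ℕ} {v x : V}
    (hc : (s n).current (π n) = some v) (hx : G.touch v = some x)
    (hrx : G.Ready (s (n + 1)) x) : G.Blocked s (n + 1) x := by
  obtain ⟨l, hl⟩ := h.exists_localParent hx
  have hmem : v ∈ stack (s n) (π n) := by simp [stack, hc]
  refine ⟨l, v, hl, hx, n, Nat.le_succ n, ?_, (hr.inv h n).not_executed_of_mem_stack hmem⟩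
  refine ((hr.executed_succ h).1 (hrx l (Or.inl hl))).resolve_right ?_
  rw [hc]
  rintro h1
  cases h1
  exact h.touch_ne_cont hx hl

/-- A touch in a deque had been blocked. -/
theorem blocked_of_mem_tail (hr : G.IsExecution p₀ π ω s) (h : G.IsComputationDag) (n : ℕ)
    (p : Fin P) (x : V) (hx : x ∈ (stack (s n) p).tail) (ht : ∃ w, G.touch w = some x) :
    G.Blocked s n x := by
  induction n generalizing p with
  | zero =>
    rw [hr.zero] at hx
    by_cases hp : p = p₀
    · subst hp; simp [stack, initState] at hx
    · simp [stack, initState, Function.update_of_ne hp] at hx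
  | succ n ih =>
    have hmono : G.Blocked s n x → G.Blocked s (n + 1) x := fun hb => hb.mono (Nat.le_succ n)
    cases hr.stepSpec h n with
    | idle hc hq he => rw [he] at hx; exact hmono (ih p hx)
    | steal w S hc hq hpq hpe hS hst ht' hs' =>
      rw [hs'] at hx
      by_cases h1 : p = π n
      · subst h1; simp at hx
      · rw [Function.update_of_ne h1] at hx
        by_cases h2 : p = ω n
        · subst h2
          refine hmono (ih (ω n) ?_)
          rw [hst, List.tail_append_of_ne_nil hS]
          rw [Function.update_self] at hx
          exact List.mem_append_left _ hx
        · rw [Function.update_of_ne h2] at hx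
          exact hmono (ih p hx)
    | exec v R hc hst ht' hs' =>
      rw [hs'] at hx
      by_cases h1 : p = π n
      · subst h1
        rw [Function.update_self] at hx
        have hR : x ∈ R → G.Blocked s (n + 1) x := fun hxR =>
          hmono (ih (π n) (by rw [hst]; exact hxR))
        have hexv : Executed (s (n + 1)) v := (hr.executed_succ h).2 (Or.inr hc)
        cases hf : G.future v with
        | some a =>
          obtain ⟨b, hb, he⟩ := enabled_fork h hexv hf
          rw [he] at hx
          simp only [List.cons_append, List.nil_append, List.tail_cons, List.mem_cons] at hx
          rcases hx with rfl | hx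
          · obtain ⟨w, hw⟩ := ht
            exact absurd hw (h.right_child_in v x w (by simp [hf]) hb)
          · exact hR hx
        | none =>
          rcases enabled_nonfork (s := s (n + 1)) hf with he | ⟨b, hb, -, he⟩ | ⟨y, hy, hry, he, -⟩ |
            ⟨b, y, hb, hy, -, hry, he⟩
          · rw [he] at hx; exact hR (List.mem_of_mem_tail hx)
          · rw [he] at hx; exact hR hx
          · rw [he] at hx; exact hR hx
          · rw [he] at hx
            simp only [List.cons_append, List.nil_append, List.tail_cons, List.mem_cons] at hx
            rcases hx with rfl | hx
            · exact hr.blocked_of_touch h hc hy hry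
            · exact hR hx
      · rw [Function.update_of_ne h1] at hx
        exact hmono (ih p hx)

/-- The root is the first node that is executed. -/
theorem root_first (hr : G.IsExecution p₀ π ω s) (h : G.IsComputationDag) (n : ℕ) :
    (((s n).trace p₀ = [] ∧ (stack (s n) p₀).head? = some G.root) ∨
      [G.root] <+: (s n).trace p₀) := by
  induction n with
  | zero => left; rw [hr.zero]; simp [initState, stack]
  | succ n ih =>
    cases hr.stepSpec h n with
    | idle hc hq he => rw [he]; exact ih
    | steal w S hc hq hpq hpe hS hst ht' hs' =>
      rw [ht', hs']
      refine ih.imp_left fun ⟨h1, h2⟩ => ⟨h1, ?_⟩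
      have h3 : p₀ ≠ π n := by
        rintro rfl
        rw [hpe] at h2; simp at h2
      rw [Function.update_of_ne h3]
      by_cases h4 : p₀ = ω n
      · subst h4
        rw [hst, List.head?_append_of_ne_nil _ hS] at h2
        rw [Function.update_self, h2]
      · rw [Function.update_of_ne h4, h2]
    | exec v R hc hst ht' hs' =>
      by_cases h1 : p₀ = π n
      · subst h1
        right
        rw [ht', Function.update_self]
        rcases ih with ⟨h2, h3⟩ | h2
        · rw [hst] at h3
          simp at h3
          rw [h2, h3, List.nil_append]
        · exact h2.trans (List.prefix_append _ _)
      · rw [ht', hs', Function.update_of_ne h1, Function.update_of_ne h1]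
        exact ih

/-- The origin of each node that is executed or about to be executed. -/
theorem origin (hr : G.IsExecution p₀ π ω s) (h : G.IsComputationDag)
    (hs : G.IsStructuredLocalTouch) (n : ℕ) (y : V) (hy : y ≠ G.root)
    (hp : Executed (s n) y ∨ ∃ p, (stack (s n) p).head? = some y) : Origin G s π ω n y := by
  induction n with
  | zero =>
    exfalso
    rw [hr.zero] at hp
    rcases hp with ⟨p, hp⟩ | ⟨p, hp⟩
    · simp [initState] at hp
    · by_cases h1 : p = p₀
      · subst h1
        simp [initState, stack] at hp
        exact hy hp.symm
      · simp [initState, stack, Function.update_of_ne h1] at hp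
  | succ n ih =>
    have i := hr.inv h n
    have old : (Executed (s n) y ∨ ∃ p, (stack (s n) p).head? = some y) →
        Origin G s π ω (n + 1) y := by
      intro ho
      refine hr.origin_succ h ?_ (ih ho)
      rcases ho with ho | ⟨p, hp⟩
      · exact i.ready_of_executed ho
      · exact i.ready_of_mem_stack (List.mem_of_head? hp)
    rcases hp with hp | ⟨p, hp⟩
    · rcases (hr.executed_succ h).1 hp with h1 | h1
      · exact old (Or.inl h1)
      · exact old (Or.inr ⟨π n, by rw [← i.current_eq, h1]⟩)
    · cases hr.stepSpec h n with
      | idle hc hq he => rw [he] at hp; exact old (Or.inr ⟨p, hp⟩)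
      | steal w S hc hq hpq hpe hS hst ht' hs' =>
        rw [hs'] at hp
        by_cases h1 : p = π n
        · subst h1
          simp at hp
          subst hp
          exact .stolen ⟨n, Nat.lt_succ_self n, hc, hq⟩
        · rw [Function.update_of_ne h1] at hp
          refine old (Or.inr ⟨p, ?_⟩)
          by_cases h2 : p = ω n
          · subst h2
            rw [Function.update_self] at hp
            rw [hst, List.head?_append_of_ne_nil _ hS, hp]
          · rwa [Function.update_of_ne h2] at hp
      | exec v R hc hst ht' hs' =>
        by_cases h1 : p = π n
        · subst h1
          have hhead := hp
          rw [hs', Function.update_self] at hp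
          have hexv : Executed (s (n + 1)) v := (hr.executed_succ h).2 (Or.inr hc)
          have hnv : ¬ Executed (s n) v := i.not_executed_of_mem_stack (p := π n) (by simp [hst])
          have himm : ImmediatelyAfter (s (n + 1)) v y :=
            ⟨π n, Or.inl ⟨hhead, (s n).trace (π n), by rw [ht', Function.update_self]⟩⟩
          have hnext : G.cont v = some y → G.Ready (s (n + 1)) y → G.future v = none →
              Origin G s π ω (n + 1) y := by
            intro hb hry hf
            refine .next v hb hf himm ?_
            rintro ⟨l, w, hl, hw, m, hm, h3, h4⟩
            obtain rfl := h.cont_inj _ _ _ hl hb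
            rcases Nat.lt_or_ge n m with h5 | h5
            · obtain rfl : m = n + 1 := by omega
              exact h4 (hry w (Or.inr (Or.inr hw)))
            · exact hnv (hr.executed_mono h h5 h3)
          cases hf : G.future v with
          | some a =>
            obtain ⟨b, hb, he⟩ := enabled_fork h hexv hf
            rw [he] at hp
            simp at hp
            subst hp
            exact .left v hf himm
          | none =>
            rcases enabled_nonfork (s := s (n + 1)) hf with he | ⟨b, hb, hrb, he⟩ |
              ⟨x, hx, hrx, he, hnb⟩ | ⟨b, x, hb, hx, hrb, -, he⟩
            · -- no child of `v` is enabled, so `y` comes from the deque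
              have hnb : ∀ b, G.cont v = some b → ¬ G.Ready (s (n + 1)) b := by
                intro b hb hrb
                have : b ∈ G.enabled (s (n + 1)) v := mem_enabled.2 ⟨Or.inl hb, hrb⟩
                rw [he] at this
                simp at this
              rw [he, List.nil_append] at hp
              obtain ⟨R', rfl⟩ : ∃ R', R = y :: R' := by
                cases R with
                | nil => simp at hp
                | cons a R' => simp at hp; subst hp; exact ⟨R', rfl⟩
              have hch := hr.chain h hs n (π n)
              rw [hst] at hch
              have hl : G.Linked v y := by simpa using hch.rel
              obtain ⟨c, ⟨f, hfy, hfc⟩ | ⟨w, hwy, hwc⟩, hcv⟩ := hl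
              · refine .right f c hfy hfc ?_
                cases hb : G.cont v with
                | none => exact Or.inr ⟨v, hcv, hb, himm⟩
                | some b =>
                  exact Or.inl ⟨b, hcv.tail hb, blocked_of_not_ready h hexv hb (hnb b hb)⟩
              · refine .touch w hwy ?_ ?_
                · exact (hr.blocked_of_mem_tail h n (π n) y (by simp [hst]) ⟨w, hwy⟩).mono
                    (Nat.le_succ n)
                · cases hb : G.cont v with
                  | none => exact Or.inr ⟨v, (follows_of_cont hwc).trans hcv, hb, hexv⟩
                  | some b =>
                    exact Or.inl ⟨b, c, hwc, hcv.tail hb,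
                      blocked_of_not_ready h hexv hb (hnb b hb)⟩
            · rw [he] at hp
              simp at hp
              subst hp
              exact hnext hb hrb hf
            · rw [he] at hp
              simp at hp
              subst hp
              refine .touch v hx (hr.blocked_of_touch h hc hx hrx) ?_
              cases hb : G.cont v with
              | none => exact Or.inr ⟨v, Follows.refl G v, hb, hexv⟩
              | some b =>
                exact Or.inl ⟨b, b, rfl, Follows.refl G b,
                  blocked_of_not_ready h hexv hb (hnb b hb)⟩
            · rw [he] at hp
              simp at hp
              subst hp
              exact hnext hb hrb hf
        · rw [hs', Function.update_of_ne h1] at hp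
          exact old (Or.inr ⟨p, hp⟩)

end IsExecution

end Origin

end FutureGraph

/-! ### Blocked touches are charged to steals -/

namespace FutureGraph

section Charging

variable {V : Type*} {G : FutureGraph V} {P : ℕ}

theorem rank_le_of_follows {rk : V → ℕ} (hrk : ∀ u v, G.Edge u v → rk u < rk v) {u v : V}
    (h : G.Follows u v) : rk u ≤ rk v := by
  induction h with
  | refl => exact le_rfl
  | tail _ e ih => exact ih.trans (hrk _ _ (Or.inl e)).le

theorem rank_lt_of_follows {rk : V → ℕ} (hrk : ∀ u v, G.Edge u v → rk u < rk v) {u v : V}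
    (h : G.Follows u v) (hne : u ≠ v) : rk u < rk v := by
  rcases ReflTransGen.cases_head h with rfl | ⟨c, hc, hcv⟩
  · exact absurd rfl hne
  · exact (hrk _ _ (Or.inl hc)).trans_le (rank_le_of_follows hrk hcv)

theorem depth_eq_of_follows {dp : V → ℕ} (hdp : ∀ u v, G.cont u = some v → dp v = dp u) {u v : V}
    (h : G.Follows u v) : dp v = dp u := by
  induction h with
  | refl => rfl
  | tail _ e ih => rw [hdp _ _ e, ih]

/-- `y` is the right child of the fork whose future thread begins at `c`, or a touch of that thread
that had been blocked. -/
def Waiting (G : FutureGraph V) (s : ℕ → WSState V P) (n : ℕ) (c r y : V) : Prop :=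
  y = r ∨ (G.Blocked s n y ∧ ∃ w, G.touch w = some y ∧ G.Follows c w)

/-- The blocked touch `x` of the future thread `c`, `w`, … of the fork `f` with right child `r`
is charged to `y`, the last node before `x` that is a blocked touch of the same future thread, or
else `r`. -/
structure Charged (G : FutureGraph V) (s : ℕ → WSState V P) (n : ℕ) (rk : V → ℕ)
    (x f c r w y : V) : Prop where
  future : G.future f = some c
  cont : G.cont f = some r
  mem : G.Follows c w
  touch : G.touch w = some x
  blocked : G.Blocked s n x
  right : G.Follows r x
  waiting : G.Waiting s n c r y
  before : G.Follows y x
  ne : y ≠ x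
  max : ∀ y', G.Waiting s n c r y' → G.Follows y' x → y' ≠ x → rk y' ≤ rk y

namespace Charged

variable {s : ℕ → WSState V P} {n : ℕ} {rk : V → ℕ} {x x' f f' c c' r r' w w' y y' : V}

theorem eq_of_fork_eq (hrk : ∀ u v, G.Edge u v → rk u < rk v)
    (h₁ : G.Charged s n rk x f c r w y) (h₂ : G.Charged s n rk x' f c r w' y) : x = x' := by
  by_contra hne
  rcases h₁.right.total h₂.right with h3 | h3
  · have h4 := h₂.max x (Or.inr ⟨h₁.blocked, w, h₁.touch, h₁.mem⟩) h3 hne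
    have h5 := rank_lt_of_follows hrk h₁.before h₁.ne
    omega
  · have h4 := h₁.max x' (Or.inr ⟨h₂.blocked, w', h₂.touch, h₂.mem⟩) h3 (Ne.symm hne)
    have h5 := rank_lt_of_follows hrk h₂.before h₂.ne
    omega

theorem eq_of_eq (h : G.IsComputationDag) (hrk : ∀ u v, G.Edge u v → rk u < rk v)
    (h₁ : G.Charged s n rk x f c r w y) (h₂ : G.Charged s n rk x' f' c' r' w' y) : x = x' := by
  have hff : f = f' := by
    rcases h₁.waiting with rfl | ⟨-, u, hu, hcu⟩
    · rcases h₂.waiting with rfl | ⟨-, u', hu', -⟩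
      · exact h.cont_inj _ _ _ h₁.cont h₂.cont
      · exact absurd hu' (h.right_child_in f _ _ (by simp [h₁.future]) h₁.cont)
    · rcases h₂.waiting with rfl | ⟨-, u', hu', hcu'⟩
      · exact absurd hu (h.right_child_in f' _ _ (by simp [h₂.future]) h₂.cont)
      · obtain rfl := h.touch_inj _ _ _ hu hu'
        exact h.fork_unique h₁.future h₂.future hcu hcu'
  subst hff
  obtain rfl : c = c' := Option.some_injective _ (h₁.future.symm.trans h₂.future)
  obtain rfl : r = r' := Option.some_injective _ (h₁.cont.symm.trans h₂.cont)
  exact eq_of_fork_eq hrk h₁ h₂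

end Charged

variable [DecidableEq V] [Fintype V]

namespace IsExecution

variable {p₀ : Fin P} {π ω : ℕ → Fin P} {s : ℕ → WSState V P}

omit [DecidableEq V] [Fintype V] in
theorem executed_of_immediatelyAfter {s : WSState V P} {y x : V} (h : ImmediatelyAfter s y x) :
    Executed s y := by
  obtain ⟨p, ⟨-, T, hT⟩ | hp⟩ := h
  · exact ⟨p, by simp [hT]⟩
  · exact ⟨p, hp.subset (by simp)⟩

/-- If a touch `x`, touched through `w`, is blocked, then the node `y` to which it is charged has
been stolen, or a node `a` up to `w` of the future thread, after the node that touches `y`, is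
itself a blocked touch. -/
theorem exists_charged (hr : G.IsExecution p₀ π ω s) (h : G.IsComputationDag)
    (hs : G.IsStructuredLocalTouch) (rk : V → ℕ) {n : ℕ} {x : V} (hx : G.Blocked s n x) :
    ∃ f c r w y, G.Charged s n rk x f c r w y ∧ (Stolen s π ω n y ∨
      ∃ a, G.Follows c a ∧ G.Blocked s n a ∧ G.Follows a w ∧
        ∀ u, G.touch u = some y → ∃ b, G.cont u = some b ∧ G.Follows b a) := by
  classical
  obtain ⟨l, w, hl, hw, m, hm, hlm, hwm⟩ := hx
  obtain ⟨f, c, r, hf, hfr, hcw, hrx, hxr⟩ := exists_fork_of_touch h hs hw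
  obtain ⟨y, hy, hmax⟩ := Finset.exists_max_image
    (Finset.univ.filter fun y => G.Waiting s n c r y ∧ G.Follows y x ∧ y ≠ x) rk
    ⟨r, by simpa using ⟨Or.inl rfl, hrx, hxr.symm⟩⟩
  simp only [Finset.mem_filter, Finset.mem_univ, true_and] at hy hmax
  obtain ⟨hy, hyx, hne⟩ := hy
  refine ⟨f, c, r, w, y, ⟨hf, hfr, hcw, hw, ⟨l, w, hl, hw, m, hm, hlm, hwm⟩, hrx, hy, hyx, hne,
    fun y' h1 h2 h3 => hmax y' ⟨h1, h2, h3⟩⟩, ?_⟩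
  have i := hr.inv h m
  have hym : Executed (s m) y := i.executed_of_follows (h.follows_pred hyx hne hl) hlm
  have hroot : y ≠ G.root := by
    rintro rfl
    rcases hy with hy | ⟨-, u, hu, -⟩
    · exact h.root_in f (Or.inl (by rw [hfr, hy]))
    · exact h.root_in u (Or.inr (Or.inr hu))
  have hr_touch : ∀ u, G.touch u ≠ some r := fun u => h.right_child_in f r u (by simp [hf]) hfr
  -- `w` has not been executed at time `m`, and all predecessors of blocked nodes have
  have hblk : ∀ a, G.Follows c a → G.Blocked s m a → G.Follows a w := by
    rintro a hca ⟨la, wa, hla, -, k, hk, hka, -⟩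
    rcases hca.total hcw with h1 | h1
    · exact h1
    · by_cases hwa : w = a
      · rw [hwa]; exact Follows.refl G a
      · exact absurd (i.executed_of_follows (h.follows_pred h1 hwa hla)
          (hr.executed_mono h hk hka)) hwm
  have hend : ∀ z, G.Follows c z → G.cont z = none → ¬ Executed (s m) z := by
    intro z hcz hz hzm
    rcases hcz.total hcw with h1 | h1
    · rw [h1.eq_of_cont_none hz] at hzm
      exact hwm hzm
    · exact hwm (i.executed_of_follows h1 hzm)
  cases hr.origin h hs m y hroot (Or.inl hym) with
  | left v hv _ =>
    rcases hy with rfl | ⟨-, u, hu, -⟩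
    · exact absurd hfr (h.left_child_in v _ f hv).1
    · exact absurd hu (h.left_child_in v _ u hv).2
  | next v hv hvf _ hb =>
    rcases hy with rfl | ⟨hy, -⟩
    · rw [h.cont_inj _ _ _ hv hfr, hf] at hvf
      cases hvf
    · exact absurd (hr.blocked_of_ready h (i.ready_of_executed hym) hy) hb
  | stolen hst => exact Or.inl (hst.mono hm)
  | right f' c' hf' hc' ho =>
    rcases hy with rfl | ⟨-, u, hu, -⟩
    · obtain rfl := h.cont_inj _ _ _ hf' hfr
      obtain rfl : c = c' := Option.some_injective _ (hf.symm.trans hc')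
      rcases ho with ⟨a, h1, h2⟩ | ⟨z, h1, h2, h3⟩
      · exact Or.inr ⟨a, h1, h2.mono hm, hblk a h1 h2, fun u hu => absurd hu (hr_touch u)⟩
      · exact absurd (executed_of_immediatelyAfter h3) (hend z h1 h2)
    · exact absurd hu (h.right_child_in f' _ u (by simp [hc']) hf')
  | touch u hu _ ho =>
    rcases hy with rfl | ⟨-, u', hu', hcu⟩
    · exact absurd hu (hr_touch u)
    · obtain rfl := h.touch_inj _ _ _ hu hu'
      rcases ho with ⟨a, b, h0, h1, h2⟩ | ⟨z, h1, h2, h3⟩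
      · have hca := (hcu.tail h0).trans h1
        refine Or.inr ⟨a, hca, h2.mono hm, hblk a hca h2, fun u' hu' => ?_⟩
        obtain rfl := h.touch_inj _ _ _ hu hu'
        exact ⟨b, h0, h1⟩
      · exact absurd h3 (hend z (hcu.trans h1) h2)

/-- A blocked touch `a` of a future thread serves only one blocked touch of that thread: two
of them would be served by nodes of disjoint segments of the future thread. -/
theorem charged_disjoint (hr : G.IsExecution p₀ π ω s) (h : G.IsComputationDag)
    (hs : G.IsStructuredLocalTouch) {rk : V → ℕ} (hrk : ∀ u v, G.Edge u v → rk u < rk v) {n : ℕ} {x x' f c r w w' y y' a : V}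
    (h₁ : G.Charged s n rk x f c r w y) (h₂ : G.Charged s n rk x' f c r w' y')
    (haw : G.Follows a w)
    (hay' : ∀ u, G.touch u = some y' → ∃ b, G.cont u = some b ∧ G.Follows b a)
    (hxx : G.Follows x x') (hne : x ≠ x') : False := by
  have hle := h₂.max x (Or.inr ⟨h₁.blocked, w, h₁.touch, h₁.mem⟩) hxx hne
  have hlt := rank_lt_of_follows hrk h₁.before h₁.ne
  have hry' : G.Follows r y' := by
    rcases h₂.waiting with rfl | ⟨-, u, hu, hcu⟩
    · exact Follows.refl G _
    · exact (follows_of_touch h hs hu h₂.future h₂.cont hcu).1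
  have hxy : G.Follows x y' := by
    rcases h₁.right.total hry' with h3 | h3
    · exact h3
    · by_cases h4 : y' = x
      · rw [h4]; exact Follows.refl G x
      · have := rank_lt_of_follows hrk h3 h4
        omega
  have hy'r : y' ≠ r := by
    rintro rfl
    have h3 := h.follows_antisymm hxy h₁.right
    subst h3
    exact h.right_child_in f x w (by simp [h₁.future]) h₁.cont h₁.touch
  obtain ⟨l', u, hl', hu, m, hm, hlm, hum⟩ := (h₂.waiting.resolve_left hy'r).1
  obtain ⟨-, u', hu', hcu⟩ := h₂.waiting.resolve_left hy'r
  obtain rfl := h.touch_inj _ _ _ hu hu'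
  obtain ⟨b, hb, hba⟩ := hay' u hu
  have hbw : G.Follows b w := hba.trans haw
  -- the node that touches `y'` comes before `w`
  by_cases hxy' : x = y'
  · subst hxy'
    obtain rfl := h.touch_inj _ _ _ hu h₁.touch
    exact h.not_follows_of_cont hb hbw
  · have i := hr.inv h m
    have h3 : Executed (s m) x := i.executed_of_follows (h.follows_pred hxy hxy' hl') hlm
    have h4 : Executed (s m) w := i.ready_of_executed h3 w (Or.inr (Or.inr h₁.touch))
    exact hum (i.executed_of_follows ((follows_of_cont hb).trans hbw) h4)

open Classical in
/-- The blocked touches of depth `d` are at most as many as the stolen nodes of depth `d` and the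
blocked touches of depth `d + 1` together. -/
theorem card_blocked_depth_le (hr : G.IsExecution p₀ π ω s) (h : G.IsComputationDag)
    (hs : G.IsStructuredLocalTouch) {dp : V → ℕ} (hdp : ∀ u v, G.cont u = some v → dp v = dp u)
    (hdp' : ∀ u v, G.future u = some v → dp v = dp u + 1) (n d : ℕ) :
    (Finset.univ.filter fun x => G.Blocked s n x ∧ dp x = d).card ≤
      (Finset.univ.filter fun x => Stolen s π ω n x ∧ dp x = d).card +
      (Finset.univ.filter fun x => G.Blocked s n x ∧ dp x = d + 1).card := by
  obtain ⟨rk, hrk⟩ := exists_rank h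
  have hch : ∀ x, ∃ e : V ⊕ V, G.Blocked s n x → ∃ f c r w y, G.Charged s n rk x f c r w y ∧
      ((e = Sum.inl y ∧ Stolen s π ω n y) ∨ ∃ a, e = Sum.inr a ∧
        G.Follows c a ∧ G.Blocked s n a ∧ G.Follows a w ∧
          ∀ u, G.touch u = some y → ∃ b, G.cont u = some b ∧ G.Follows b a) := by
    intro x
    by_cases hx : G.Blocked s n x
    · obtain ⟨f, c, r, w, y, h1, h2 | ⟨a, h2⟩⟩ := hr.exists_charged h hs rk hx
      · exact ⟨Sum.inl y, fun _ => ⟨f, c, r, w, y, h1, Or.inl ⟨rfl, h2⟩⟩⟩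
      · exact ⟨Sum.inr a, fun _ => ⟨f, c, r, w, y, h1, Or.inr ⟨a, rfl, h2⟩⟩⟩
    · exact ⟨Sum.inl x, fun hx' => absurd hx' hx⟩
  choose e he using hch
  rw [← Finset.card_disjSum]
  refine Finset.card_le_card_of_injOn e ?_ ?_
  · intro x hx
    simp only [Finset.coe_filter, Finset.mem_univ, true_and, Set.mem_ofPred_eq] at hx
    obtain ⟨f, c, r, w, y, h1, ⟨h2, h3⟩ | ⟨a, h2, h3, h4, -⟩⟩ := he x hx.1
    · rw [Finset.mem_coe, h2, Finset.inl_mem_disjSum]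
      simp only [Finset.mem_filter, Finset.mem_univ, true_and]
      exact ⟨h3, by rw [← depth_eq_of_follows hdp h1.before, hx.2]⟩
    · rw [Finset.mem_coe, h2, Finset.inr_mem_disjSum]
      simp only [Finset.mem_filter, Finset.mem_univ, true_and]
      refine ⟨h4, ?_⟩
      rw [depth_eq_of_follows hdp h3, hdp' _ _ h1.future, ← hdp _ _ h1.cont,
        ← depth_eq_of_follows hdp h1.right, hx.2]
  · intro x hx x' hx' hee
    simp only [Finset.coe_filter, Finset.mem_univ, true_and, Set.mem_ofPred_eq] at hx hx'
    obtain ⟨f, c, r, w, y, h1, ⟨h2, h3⟩ | ⟨a, h2, h3, h4, h5, h6⟩⟩ := he x hx.1 <;>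
    obtain ⟨f', c', r', w', y', h1', ⟨h2', h3'⟩ | ⟨a', h2', h3', h4', h5', h6'⟩⟩ := he x' hx'.1
    · rw [h2, h2'] at hee
      cases hee
      exact h1.eq_of_eq h hrk h1'
    · rw [h2, h2'] at hee; cases hee
    · rw [h2, h2'] at hee; cases hee
    · rw [h2, h2'] at hee
      cases hee
      obtain rfl := h.fork_unique h1.future h1'.future h3 h3'
      obtain rfl : c = c' := Option.some_injective _ (h1.future.symm.trans h1'.future)
      obtain rfl : r = r' := Option.some_injective _ (h1.cont.symm.trans h1'.cont)
      by_contra hne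
      rcases h1.right.total h1'.right with h7 | h7
      · exact hr.charged_disjoint h hs hrk h1 h1' h5 h6' h7 hne
      · exact hr.charged_disjoint h hs hrk h1' h1 h5' h6 h7 (Ne.symm hne)

open Classical in
/-- Each steal accounts for at most one blocked touch of each depth. -/
theorem card_blocked_le (hr : G.IsExecution p₀ π ω s) (h : G.IsComputationDag)
    (hs : G.IsStructuredLocalTouch) (n : ℕ) :
    (Finset.univ.filter fun x => G.Blocked s n x).card ≤
      G.span * (Finset.univ.filter fun x => Stolen s π ω n x).card := by
  obtain ⟨dp, hdp, hdp', hspan⟩ := exists_depth h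
  have hlt : ∀ x, G.Blocked s n x → dp x < G.span := by
    rintro x ⟨l, w, hl, hw, -⟩
    obtain ⟨f, c, r, hf, hfr, hcw, hrx, -⟩ := exists_fork_of_touch h hs hw
    have := hspan c
    rw [hdp' _ _ hf] at this
    rw [depth_eq_of_follows hdp hrx, hdp _ _ hfr]
    omega
  have key : ∀ k d, d + k = G.span →
      (Finset.univ.filter fun x => G.Blocked s n x ∧ dp x = d).card ≤
        (Finset.univ.filter fun x => Stolen s π ω n x ∧ d ≤ dp x).card := by
    intro k
    induction k with
    | zero =>
      intro d hd
      rw [Finset.card_eq_zero.2]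
      · exact Nat.zero_le _
      · rw [Finset.filter_eq_empty_iff]
        rintro x - ⟨hx, hxd⟩
        have := hlt x hx
        omega
    | succ k ih =>
      intro d hd
      refine (hr.card_blocked_depth_le h hs hdp hdp' n d).trans ?_
      refine (Nat.add_le_add_left (ih (d + 1) (by omega)) _).trans ?_
      rw [← Finset.card_union_of_disjoint]
      · refine Finset.card_le_card fun x hx => ?_
        simp only [Finset.mem_union, Finset.mem_filter, Finset.mem_univ, true_and] at hx ⊢
        rcases hx with ⟨h1, h2⟩ | ⟨h1, h2⟩
        · exact ⟨h1, h2.ge⟩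
        · exact ⟨h1, by omega⟩
      · rw [Finset.disjoint_filter]
        rintro x - ⟨-, h1⟩ ⟨-, h2⟩
        omega
  rw [Finset.card_eq_sum_card_fiberwise (f := dp) (t := Finset.range G.span)]
  · refine (Finset.sum_le_card_nsmul _ _ _ fun d hd => ?_).trans
      (by rw [Finset.card_range, smul_eq_mul])
    rw [Finset.filter_filter]
    refine (key (G.span - d) d (by have := Finset.mem_range.1 hd; omega)).trans ?_
    refine Finset.card_le_card fun x hx => ?_
    simp only [Finset.mem_filter, Finset.mem_univ, true_and] at hx ⊢
    exact hx.1
  · intro x hx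
    simp only [Finset.coe_filter, Finset.mem_univ, true_and, Set.mem_ofPred_eq] at hx
    simpa using hlt x hx

end IsExecution

end Charging

end FutureGraph

/-! ### The sequential order and the deviations -/

namespace FutureGraph

section Deviations

theorem eq_of_pair_infix {α : Type*} {l : List α} (hl : l.Nodup) {a b x : α} (ha : [a, x] <:+: l)
    (hb : [b, x] <:+: l) : a = b := by
  obtain ⟨A, A', hA⟩ := ha
  obtain ⟨B, B', hB⟩ := hb
  have h1 : l = (A ++ [a]) ++ x :: A' := by rw [← hA]; simp
  have h2 : l = (B ++ [b]) ++ x :: B' := by rw [← hB]; simp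
  have hxA : x ∉ A ++ [a] := by
    rw [h1] at hl
    intro hx
    exact List.disjoint_of_nodup_append hl hx (by simp)
  have hxB : x ∉ B ++ [b] := by
    rw [h2] at hl
    intro hx
    exact List.disjoint_of_nodup_append hl hx (by simp)
  have h3 : A ++ [a] = B ++ [b] := by
    rw [h1] at h2
    rcases List.append_eq_append_iff.1 h2 with ⟨C, hC, hC'⟩ | ⟨C, hC, hC'⟩
    · cases C with
      | nil => simpa using hC.symm
      | cons c C =>
        simp at hC'
        rw [hC, ← hC'.1] at hxB
        simp at hxB
    · cases C with
      | nil => simpa using hC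
      | cons c C =>
        simp at hC'
        rw [hC, ← hC'.1] at hxA
        simp at hxA
  simpa using (List.append_inj' h3 rfl).2

theorem not_pair_infix_of_prefix {α : Type*} {l : List α} (hl : l.Nodup) {r y : α}
    (hr : [r] <+: l) : ¬ [y, r] <:+: l := by
  rintro ⟨A, B, hA⟩
  obtain ⟨T, hT⟩ := hr
  rw [← hT] at hA hl
  cases A with
  | nil =>
    simp at hA
    rw [← hA.2] at hl
    simp at hl
  | cons c A =>
    simp at hA
    rw [← hA.2] at hl
    simp at hl

theorem exists_pair_infix_of_ne_head {α : Type*} {l : List α} {r x : α} (hr : [r] <+: l)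
    (hx : x ∈ l) (hne : x ≠ r) : ∃ y, [y, x] <:+: l := by
  obtain ⟨A, B, rfl⟩ := List.append_of_mem hx
  rcases List.eq_nil_or_concat A with rfl | ⟨A', y, rfl⟩
  · obtain ⟨T, hT⟩ := hr
    simp at hT
    exact absurd hT.1.symm hne
  · exact ⟨y, A', B, by simp⟩

variable {V : Type*} {G : FutureGraph V} [DecidableEq V] [Fintype V]

section Sequential

theorem Inv.exists_current {P : ℕ} {s : WSState V P} (i : G.Inv s) (h : G.IsComputationDag)
    {v : V} (hv : ¬ Executed s v) : ∃ p, s.current p ≠ none := by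
  obtain ⟨rk, hrk⟩ := exists_rank h
  induction hn : rk v using Nat.strong_induction_on generalizing v with
  | _ n ih =>
    by_cases hr : G.Ready s v
    · obtain ⟨p, hp⟩ := (i.executed_or_mem_stack hr).resolve_left hv
      refine ⟨p, fun hc => ?_⟩
      simp [stack, hc, i.idle p hc] at hp
    · unfold Ready at hr
      push Not at hr
      obtain ⟨u, e, hu⟩ := hr
      exact ih (rk u) (hn ▸ hrk u v e) hu rfl

/-- The configurations of the sequential execution. -/
def seqRun (G : FutureGraph V) (n : ℕ) : WSState V 1 := G.run (P := 1) 0 (fun _ => 0) (fun _ => 0) n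

theorem isExecution_seqRun (G : FutureGraph V) :
    G.IsExecution (0 : Fin 1) (fun _ => 0) (fun _ => 0) G.seqRun :=
  isExecution_run G 0 (fun _ => 0) (fun _ => 0)

theorem executed_or_length (h : G.IsComputationDag) (n : ℕ) :
    (∀ v, Executed (G.seqRun n) v) ∨ ((G.seqRun n).trace 0).length = n := by
  have hr := isExecution_seqRun G
  induction n with
  | zero => right; rw [hr.zero]; rfl
  | succ n ih =>
    by_cases hall : ∀ v, Executed (G.seqRun n) v
    · exact Or.inl fun v => (hr.executed_succ h).2 (Or.inl (hall v))
    · right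
      have hlen := ih.resolve_left hall
      push Not at hall
      obtain ⟨v, hv⟩ := hall
      obtain ⟨p, hp⟩ := (hr.inv h n).exists_current h hv
      obtain rfl : p = 0 := Subsingleton.elim _ _
      cases hr.stepSpec h n with
      | idle hc hq he => exact absurd hc hp
      | steal x S hc hq hpq hpe hS hst ht hs' => exact absurd hc hp
      | exec w R hc hst ht hs' => rw [ht]; simp [hlen]

theorem nodup_seqOrder (h : G.IsComputationDag) : G.seqOrder.Nodup :=
  ((isExecution_seqRun G).inv h (Fintype.card V)).nodup_trace 0

theorem mem_seqOrder (h : G.IsComputationDag) (v : V) : v ∈ G.seqOrder := by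
  rcases executed_or_length (G := G) h (Fintype.card V) with h1 | h1
  · obtain ⟨p, hp⟩ := h1 v
    rwa [Subsingleton.elim p 0] at hp
  · have hnd := nodup_seqOrder h
    have h2 : (G.seqOrder.toFinset).card = Fintype.card V := by
      rw [List.toFinset_card_of_nodup hnd]; exact h1
    rw [← List.mem_toFinset, Finset.eq_univ_of_card _ h2]
    exact Finset.mem_univ v

theorem root_prefix_seqOrder (h : G.IsComputationDag) : [G.root] <+: G.seqOrder := by
  rcases (isExecution_seqRun G).root_first h (Fintype.card V) with ⟨h1, -⟩ | h1
  · have := mem_seqOrder h G.root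
    rw [show G.seqOrder = [] from h1] at this
    simp at this
  · exact h1

theorem not_stolen_seqRun (h : G.IsComputationDag) (n : ℕ) (y : V) :
    ¬ Stolen G.seqRun (fun _ => 0) (fun _ => 0) n y := by
  rintro ⟨m, -, hc, hd⟩
  rw [((isExecution_seqRun G).inv h m).idle _ hc] at hd
  simp at hd

theorem not_blocked_seqRun (h : G.IsComputationDag) (hs : G.IsStructuredLocalTouch) (n : ℕ)
    (x : V) : ¬ G.Blocked G.seqRun n x := by
  classical
  intro hx
  have := (isExecution_seqRun G).card_blocked_le h hs n
  rw [Finset.filter_false_of_mem fun y _ => not_stolen_seqRun h n y, Finset.card_empty, mul_zero,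
    Nat.le_zero, Finset.card_eq_zero] at this
  exact absurd (Finset.mem_filter.2 ⟨Finset.mem_univ x, hx⟩) (by rw [this]; simp)

omit [Fintype V] in
theorem infix_of_immediatelyAfter {P : ℕ} {s : WSState V P} (i : G.Inv s) {p : Fin P} {y x : V}
    (ha : ImmediatelyAfter s y x) (hx : x ∈ s.trace p) : [y, x] <:+: s.trace p := by
  obtain ⟨q, ⟨hq, -⟩ | hq⟩ := ha
  · exact absurd ⟨p, hx⟩ (i.not_executed_of_mem_stack (List.mem_of_head? hq))
  · have hxq : x ∈ s.trace q := hq.subset (by simp)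
    rwa [i.trace_unique hx hxq]

/-- The node that precedes `x` in the sequential execution: the parent of `x`, unless `x` is the
right child of a fork; in that case, the last node of the future thread of this fork. -/
theorem seqOrder_pred (h : G.IsComputationDag) (hs : G.IsStructuredLocalTouch) {x : V}
    (hx : x ≠ G.root) :
    (∃ v, G.future v = some x ∧ [v, x] <:+: G.seqOrder) ∨
    (∃ v, G.cont v = some x ∧ G.future v = none ∧ [v, x] <:+: G.seqOrder) ∨
    ∃ f c z, G.cont f = some x ∧ G.future f = some c ∧ G.Follows c z ∧ G.cont z = none ∧
      [z, x] <:+: G.seqOrder := by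
  have hr := isExecution_seqRun G
  have hmem := mem_seqOrder h x
  have i := hr.inv h (Fintype.card V)
  cases hr.origin h hs (Fintype.card V) x hx (Or.inl ⟨0, hmem⟩) with
  | left v hv ha => exact Or.inl ⟨v, hv, infix_of_immediatelyAfter i ha hmem⟩
  | next v hv hf ha hb => exact Or.inr (Or.inl ⟨v, hv, hf, infix_of_immediatelyAfter i ha hmem⟩)
  | stolen hst => exact absurd hst (not_stolen_seqRun h _ _)
  | right f c hf hc ho =>
    rcases ho with ⟨a, -, ha⟩ | ⟨z, hz, hz', ha⟩
    · exact absurd ha (not_blocked_seqRun h hs _ a)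
    · exact Or.inr (Or.inr ⟨f, c, z, hf, hc, hz, hz', infix_of_immediatelyAfter i ha hmem⟩)
  | touch w hw hb ho => exact absurd hb (not_blocked_seqRun h hs _ x)

end Sequential

variable {P : ℕ}

/-- A deviation is a stolen node, a blocked touch, or the right child of a fork whose future
thread has a blocked touch. -/
theorem IsExecution.deviation_cases {p₀ : Fin P} {π ω : ℕ → Fin P} {s : ℕ → WSState V P}
    (hr : G.IsExecution p₀ π ω s) (h : G.IsComputationDag) (hs : G.IsStructuredLocalTouch)
    {n : ℕ} {x : V} (hx : G.IsDeviation (s n) x) :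
    Stolen s π ω n x ∨ G.Blocked s n x ∨
      ∃ f c a, G.cont f = some x ∧ G.future f = some c ∧ G.Follows c a ∧ G.Blocked s n a := by
  obtain ⟨y, p, hyx, hxp, hn⟩ := hx
  have hroot : x ≠ G.root := by
    rintro rfl
    exact not_pair_infix_of_prefix (nodup_seqOrder h) (root_prefix_seqOrder h) hyx
  have i := hr.inv h n
  have hdev : ∀ v, ImmediatelyAfter (s n) v x → ¬ [v, x] <:+: G.seqOrder := by
    intro v hv hvx
    obtain rfl := eq_of_pair_infix (nodup_seqOrder h) hyx hvx
    exact hn (infix_of_immediatelyAfter i hv hxp)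
  have hseq := seqOrder_pred h hs hroot
  cases hr.origin h hs n x hroot (Or.inl ⟨p, hxp⟩) with
  | left v hv ha =>
    rcases hseq with ⟨v', hv', hi⟩ | ⟨v', hv', -, hi⟩ | ⟨f, c, z, hf, -⟩
    · obtain rfl := h.future_inj _ _ _ hv hv'
      exact absurd hi (hdev v ha)
    · exact absurd hv' (h.left_child_in v x v' hv).1
    · exact absurd hf (h.left_child_in v x f hv).1
  | next v hv hvf ha hb =>
    rcases hseq with ⟨v', hv', hi⟩ | ⟨v', hv', -, hi⟩ | ⟨f, c, z, hf, hc, -⟩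
    · exact absurd hv (h.left_child_in v' x v hv').1
    · obtain rfl := h.cont_inj _ _ _ hv hv'
      exact absurd hi (hdev v ha)
    · obtain rfl := h.cont_inj _ _ _ hv hf
      rw [hvf] at hc; cases hc
  | stolen hst => exact Or.inl hst
  | right f c hf hc ho =>
    rcases ho with ⟨a, ha, hb⟩ | ⟨z, hz, hz', ha⟩
    · exact Or.inr (Or.inr ⟨f, c, a, hf, hc, ha, hb⟩)
    · exfalso
      rcases hseq with ⟨v', hv', hi⟩ | ⟨v', hv', hv'', hi⟩ | ⟨f', c', z', hf', hc', hz2, hz2', hi⟩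
      · exact (h.left_child_in v' x f hv').1 hf
      · obtain rfl := h.cont_inj _ _ _ hf hv'
        rw [hv''] at hc; cases hc
      · obtain rfl := h.cont_inj _ _ _ hf hf'
        obtain rfl : c = c' := Option.some_injective _ (hc.symm.trans hc')
        have hzz : z = z' := by
          rcases hz.total hz2 with h1 | h1
          · exact h1.eq_of_cont_none hz'
          · exact (h1.eq_of_cont_none hz2').symm
        subst hzz
        exact hdev z ha hi
  | touch w hw hb ho => exact Or.inr (Or.inl hb)

open Classical in
/-- Each steal accounts for at most `3 T` deviations, where `T` is the span. -/
theorem IsExecution.ncard_deviations_le {p₀ : Fin P} {π ω : ℕ → Fin P} {s : ℕ → WSState V P}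
    (hr : G.IsExecution p₀ π ω s) (h : G.IsComputationDag) (hs : G.IsStructuredLocalTouch)
    (n : ℕ) : {x | G.IsDeviation (s n) x}.ncard ≤
      3 * G.span * (Finset.univ.filter fun x => Stolen s π ω n x).card := by
  by_cases hspan : G.span = 0
  · have : {x | G.IsDeviation (s n) x} = ∅ := by
      refine Set.eq_empty_of_forall_notMem fun x hx => ?_
      obtain ⟨y, p, hyx, -, -⟩ := hx
      have hroot : x ≠ G.root := by
        rintro rfl
        exact not_pair_infix_of_prefix (nodup_seqOrder h) (root_prefix_seqOrder h) hyx
      have : ∃ u, G.Edge u x := by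
        rcases h.exists_in x hroot with ⟨u, hu⟩ | ⟨u, hu⟩
        · exact ⟨u, Or.inl hu⟩
        · exact ⟨u, Or.inr (Or.inl hu)⟩
      obtain ⟨u, e⟩ := this
      have := ((HasPath.zero G u).succ e).le_span h
      omega
    rw [this]; simp
  · set S := Finset.univ.filter fun x => Stolen s π ω n x with hS
    set B := Finset.univ.filter fun x => G.Blocked s n x with hB
    set R := Finset.univ.filter fun x => ∃ f c a, G.cont f = some x ∧ G.future f = some c ∧
      G.Follows c a ∧ G.Blocked s n a with hR
    have hle : B.card ≤ G.span * S.card := hr.card_blocked_le h hs n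
    have hRB : R.card ≤ B.card := by
      have hex : ∀ x, ∃ a, x ∈ R → ∃ f c, G.cont f = some x ∧ G.future f = some c ∧
          G.Follows c a ∧ G.Blocked s n a := by
        intro x
        by_cases hx : x ∈ R
        · obtain ⟨f, c, a, h1⟩ := (Finset.mem_filter.1 hx).2
          exact ⟨a, fun _ => ⟨f, c, h1⟩⟩
        · exact ⟨x, fun hx' => absurd hx' hx⟩
      choose a ha using hex
      refine Finset.card_le_card_of_injOn a (fun x hx => ?_) (fun x hx x' hx' hee => ?_)
      · obtain ⟨f, c, -, -, -, h1⟩ := ha x hx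
        simpa [hB] using h1
      · obtain ⟨f, c, h1, h2, h3, -⟩ := ha x hx
        obtain ⟨f', c', h1', h2', h3', -⟩ := ha x' hx'
        rw [← hee] at h3'
        obtain rfl := h.fork_unique h2 h2' h3 h3'
        exact Option.some_injective _ (h1.symm.trans h1')
    have hsub : {x | G.IsDeviation (s n) x} ⊆ ((S ∪ (B ∪ R) : Finset V) : Set V) := by
      intro x hx
      have := hr.deviation_cases h hs hx
      simpa [hS, hB, hR] using this
    refine (Set.ncard_le_ncard hsub (Set.toFinite _)).trans ?_
    rw [Set.ncard_coe_finset]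
    refine (Finset.card_union_le _ _).trans ?_
    have h1 := Finset.card_union_le B R
    have h2 : S.card ≤ G.span * S.card := Nat.le_mul_of_pos_left _ (Nat.pos_of_ne_zero hspan)
    calc S.card + (B ∪ R).card ≤ G.span * S.card + (G.span * S.card + G.span * S.card) := by omega
      _ = 3 * G.span * S.card := by ring

end Deviations

end FutureGraph

/-! ### Additional cache misses -/

section Cache

variable {M : Type*} [DecidableEq M] {C : ℕ}

/-- The content of an LRU cache with `C` lines after a sequence of accesses. -/
def lruCache (C : ℕ) : List M → List M → List M
  | c, [] => c
  | c, b :: bs => lruCache C ((b :: c.erase b).take C) bs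

theorem lruMisses_append (c l l' : List M) :
    lruMisses C c (l ++ l') = lruMisses C c l + lruMisses C (lruCache C c l) l' := by
  induction l generalizing c with
  | nil => simp [lruMisses, lruCache]
  | cons b bs ih => simp only [List.cons_append, lruMisses, lruCache, ih, add_assoc]

theorem lruCache_append (c l l' : List M) :
    lruCache C c (l ++ l') = lruCache C (lruCache C c l) l' := by
  induction l generalizing c with
  | nil => rfl
  | cons b bs ih => simp only [List.cons_append, lruCache, ih]

theorem length_lruCache_le {c : List M} (hc : c.length ≤ C) (l : List M) :
    (lruCache C c l).length ≤ C := by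
  induction l generalizing c with
  | nil => exact hc
  | cons b bs ih => exact ih (List.length_take_le _ _)

/-- Two caches are `k`-close if they agree or have a common prefix of length at least `C - k`.
Then the first has at most `k` more misses than the second, on any sequence of accesses. -/
def CacheClose (C k : ℕ) (c c' : List M) : Prop :=
  c = c' ∨ ∃ u, u <+: c ∧ u <+: c' ∧ C ≤ u.length + k

omit [DecidableEq M] in
theorem CacheClose.all (c c' : List M) : CacheClose C C c c' :=
  Or.inr ⟨[], List.nil_prefix, List.nil_prefix, by simp⟩

theorem CacheClose.access {k : ℕ} {c c' : List M} (hc : CacheClose C k c c')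
    (hl : c'.length ≤ C) (b : M) :
    ∃ k', CacheClose C k' ((b :: c.erase b).take C) ((b :: c'.erase b).take C) ∧
      (if b ∈ c then 0 else 1) + k' ≤ (if b ∈ c' then 0 else 1) + k := by
  rcases hc with rfl | ⟨u, ⟨d, rfl⟩, ⟨d', rfl⟩, hu⟩
  · exact ⟨k, Or.inl rfl, le_rfl⟩
  · by_cases hb : b ∈ u
    · refine ⟨k, Or.inr ⟨(b :: u.erase b).take C, ?_, ?_, ?_⟩, by simp [hb]⟩
      · rw [List.erase_append_left _ hb, ← List.cons_append]
        exact (List.prefix_append _ _).take C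
      · rw [List.erase_append_left _ hb, ← List.cons_append]
        exact (List.prefix_append _ _).take C
      · have := List.length_pos_of_mem hb
        simp only [List.length_take, List.length_cons, List.length_erase_of_mem hb]
        omega
    · refine ⟨k - 1, Or.inr ⟨(b :: u).take C, ?_, ?_, ?_⟩, ?_⟩
      · rw [List.erase_append_right _ hb, ← List.cons_append]
        exact (List.prefix_append _ _).take C
      · rw [List.erase_append_right _ hb, ← List.cons_append]
        exact (List.prefix_append _ _).take C
      · simp only [List.length_take, List.length_cons]
        omega
      · rcases Nat.eq_zero_or_pos k with rfl | hk
        · -- the second cache is full with the common prefix, so it misses, too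
          have hd : d' = [] := by
            rw [List.length_append] at hl
            exact List.length_eq_zero_iff.1 (by omega)
          rw [hd, List.append_nil, if_neg hb]
          split_ifs <;> omega
        · split_ifs <;> omega

theorem CacheClose.accesses {k : ℕ} {c c' : List M} (hc : CacheClose C k c c')
    (hl : c'.length ≤ C) (l : List M) :
    ∃ k', CacheClose C k' (lruCache C c l) (lruCache C c' l) ∧
      lruMisses C c l + k' ≤ lruMisses C c' l + k := by
  induction l generalizing k c c' with
  | nil => exact ⟨k, hc, le_rfl⟩
  | cons b bs ih =>
    obtain ⟨k₁, h1, h2⟩ := hc.access hl b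
    obtain ⟨k₂, h3, h4⟩ := ih h1 (List.length_take_le _ _)
    refine ⟨k₂, h3, ?_⟩
    simp only [lruMisses]
    omega

variable {V : Type*} [DecidableEq V] (access : V → List M)

/-- The content of the cache right before `x` when the nodes are executed in the order `L`. -/
def cacheBefore (C : ℕ) (L : List V) (x : V) : List M :=
  lruCache C [] ((L.take (L.idxOf x)).flatMap access)

/-- The number of misses at `x` when the nodes are executed in the order `L`. -/
def missesAt (C : ℕ) (L : List V) (x : V) : ℕ :=
  lruMisses C (cacheBefore access C L x) (access x)

theorem cacheBefore_eq {L A B : List V} {x : V} (hL : L.Nodup) (h : L = A ++ x :: B) :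
    cacheBefore access C L x = lruCache C [] (A.flatMap access) := by
  have hx : x ∉ A := fun hx => List.disjoint_of_nodup_append (h ▸ hL) hx (by simp)
  unfold cacheBefore
  rw [h, List.idxOf_append_of_notMem hx]
  simp

theorem cacheBefore_of_pair_infix {L : List V} {x y : V} (hL : L.Nodup) (h : [y, x] <:+: L) :
    cacheBefore access C L x = lruCache C (cacheBefore access C L y) (access y) := by
  obtain ⟨A, B, hA⟩ := h
  rw [cacheBefore_eq access (A := A ++ [y]) (B := B) hL (by rw [← hA]; simp),
    cacheBefore_eq access (A := A) (B := x :: B) hL (by rw [← hA]; simp), List.flatMap_append,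
    lruCache_append]
  simp

theorem sum_missesAt {L : List V} (hL : L.Nodup) :
    (L.map (missesAt access C L)).sum = lruMisses C [] (L.flatMap access) := by
  have key : ∀ A, A <+: L →
      (A.map (missesAt access C L)).sum = lruMisses C [] (A.flatMap access) := by
    intro A
    induction A using List.reverseRecOn with
    | nil => intro _; rfl
    | append_singleton A x ih =>
      intro hA
      obtain ⟨B, hB⟩ := hA
      rw [List.map_append, List.sum_append, ih ⟨[x] ++ B, by rw [← hB]; simp⟩,
        List.flatMap_append, lruMisses_append,
        ← cacheBefore_eq access (B := B) (x := x) hL (by rw [← hB]; simp)]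
      simp [missesAt]
  exact key L List.prefix_rfl

open Classical in
/-- If the nodes of `T` are executed in this order, then compared with the order `L` at most `C`
additional misses occur for each node that does not follow its predecessor in `L`. -/
theorem lruMisses_trace_le {L T : List V} {r : V} (hL : L.Nodup) (hrL : [r] <+: L) (hT : T.Nodup)
    (hTL : ∀ x ∈ T, x ∈ L) (hrT : r ∈ T → [r] <+: T) (D : V → Prop)
    (hD : ∀ x ∈ T, ∀ y, [y, x] <:+: L → ¬ [y, x] <:+: T → D x) :
    lruMisses C [] (T.flatMap access) ≤
      (T.map fun x => missesAt access C L x + C * if D x then 1 else 0).sum := by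
  have hlen : ∀ x, (cacheBefore access C L x).length ≤ C := fun x =>
    length_lruCache_le (by simp) _
  have step : ∀ A x k, CacheClose C k (lruCache C [] (A.flatMap access))
      (cacheBefore access C L x) → ∃ k', CacheClose C k'
        (lruCache C [] ((A ++ [x]).flatMap access))
        (lruCache C (cacheBefore access C L x) (access x)) ∧
        lruMisses C [] ((A ++ [x]).flatMap access) + k' ≤
          lruMisses C [] (A.flatMap access) + missesAt access C L x + k := by
    intro A x k hk
    obtain ⟨k', h1, h2⟩ := hk.accesses (hlen x) (access x)
    refine ⟨k', ?_, ?_⟩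
    · rw [List.flatMap_append, lruCache_append]; simpa using h1
    · rw [List.flatMap_append, lruMisses_append]
      simp only [List.flatMap_cons, List.flatMap_nil, List.append_nil]
      unfold missesAt
      omega
  have hdev : ∀ A x, A ++ [x] <+: T → x ≠ r → (∀ y, A.getLast? = some y → ¬ [y, x] <:+: L) →
      D x := by
    intro A x hA hxr hy
    have hxT : x ∈ T := hA.subset (by simp)
    obtain ⟨y, hyx⟩ :=
      FutureGraph.exists_pair_infix_of_ne_head hrL (hTL x hxT) hxr
    refine hD x hxT y hyx fun hyT => ?_
    rcases List.eq_nil_or_concat A with rfl | ⟨A', z, rfl⟩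
    · exact FutureGraph.not_pair_infix_of_prefix hT hA hyT
    · have hz : [z, x] <:+: T := by
        refine List.IsInfix.trans ⟨A', [], ?_⟩ hA.isInfix
        simp
      exact hy y (by simp [FutureGraph.eq_of_pair_infix hT hz hyT]) hyx
  have key : ∀ A, A <+: T → ∃ k, lruMisses C [] (A.flatMap access) + k ≤
      (A.map fun x => missesAt access C L x + C * if D x then 1 else 0).sum ∧
      ∀ x, A.getLast? = some x → CacheClose C k (lruCache C [] (A.flatMap access))
        (lruCache C (cacheBefore access C L x) (access x)) := by
    intro A
    induction A using List.reverseRecOn with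
    | nil => intro _; exact ⟨0, by simp [lruMisses], by simp⟩
    | append_singleton A x ih =>
      intro hA
      obtain ⟨k, h1, h2⟩ := ih ((List.prefix_append A [x]).trans hA)
      have fin : ∀ k₀, CacheClose C k₀ (lruCache C [] (A.flatMap access))
          (cacheBefore access C L x) → k₀ ≤ k + C * (if D x then 1 else 0) →
          ∃ k, lruMisses C [] ((A ++ [x]).flatMap access) + k ≤
            ((A ++ [x]).map fun x => missesAt access C L x + C * if D x then 1 else 0).sum ∧
            ∀ y, (A ++ [x]).getLast? = some y →
              CacheClose C k (lruCache C [] ((A ++ [x]).flatMap access))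
                (lruCache C (cacheBefore access C L y) (access y)) := by
        intro k₀ h3 h4
        obtain ⟨k', h5, h6⟩ := step A x k₀ h3
        refine ⟨k', ?_, ?_⟩
        · rw [List.map_append, List.sum_append]
          simp only [List.map_cons, List.map_nil, List.sum_cons, List.sum_nil]
          omega
        · intro y hy
          simp at hy
          subst hy
          exact h5
      by_cases hDx : D x
      · exact fin C (CacheClose.all _ _) (by simp [hDx])
      · have hcase : x = r ∨ ∃ y, A.getLast? = some y ∧ [y, x] <:+: L := by
          by_contra hcon
          push Not at hcon
          exact hDx (hdev A x hA hcon.1 hcon.2)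
        rcases hcase with rfl | ⟨y, hy, hyx⟩
        · -- the root is executed first, with empty caches in both orders
          have hA0 : A = [] := by
            have hxT : x ∈ T := hA.subset (by simp)
            rcases List.eq_nil_or_concat A with rfl | ⟨A', z, rfl⟩
            · rfl
            · refine absurd ?_ (FutureGraph.not_pair_infix_of_prefix (y := z) hT (hrT hxT))
              refine List.IsInfix.trans ⟨A', [], ?_⟩ hA.isInfix
              simp
          subst hA0
          obtain ⟨B, hB⟩ := hrL
          refine fin 0 (Or.inl ?_) (Nat.zero_le _)
          rw [cacheBefore_eq access (A := []) (B := B) hL (by rw [← hB]; simp)]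
        · refine fin k ?_ (by omega)
          rw [cacheBefore_of_pair_infix access hL hyx]
          exact h2 y hy
  obtain ⟨k, hk, -⟩ := key T List.prefix_rfl
  omega

end Cache

namespace FutureGraph

variable {V : Type*} {G : FutureGraph V} [DecidableEq V] [Fintype V] {P : ℕ} {M : Type*}
  [DecidableEq M]

/-- Each deviation accounts for at most `C` additional cache misses. -/
theorem IsExecution.sum_lruMisses_le {p₀ : Fin P} {π ω : ℕ → Fin P} {s : ℕ → WSState V P}
    (hr : G.IsExecution p₀ π ω s) (h : G.IsComputationDag) (C : ℕ) (access : V → List M)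
    (n : ℕ) : ∑ p, lruMisses C [] (((s n).trace p).flatMap access) ≤
      G.seqCacheMisses C access + C * {x | G.IsDeviation (s n) x}.ncard := by
  classical
  have i := hr.inv h n
  have hroot : ∀ p, G.root ∈ (s n).trace p → [G.root] <+: (s n).trace p := by
    intro p hp
    rcases hr.root_first h n with ⟨-, h1⟩ | h1
    · exact absurd ⟨p, hp⟩ (i.not_executed_of_mem_stack (List.mem_of_head? h1))
    · rwa [i.trace_unique hp (h1.subset (by simp))]
  set wt : V → ℕ := fun x =>
    missesAt access C G.seqOrder x + C * if G.IsDeviation (s n) x then 1 else 0 with hwt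
  have h1 : ∀ p, lruMisses C [] (((s n).trace p).flatMap access) ≤
      ∑ x ∈ ((s n).trace p).toFinset, wt x := by
    intro p
    rw [List.sum_toFinset _ (i.nodup_trace p)]
    exact lruMisses_trace_le access (nodup_seqOrder h) (root_prefix_seqOrder h) (i.nodup_trace p)
      (fun x _ => mem_seqOrder h x) (hroot p) _ fun x hx y hyx hn => ⟨y, p, hyx, hx, hn⟩
  refine (Finset.sum_le_sum fun p _ => h1 p).trans ?_
  rw [← Finset.sum_biUnion]
  · refine (Finset.sum_le_sum_of_subset (Finset.subset_univ _)).trans ?_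
    rw [hwt, Finset.sum_add_distrib, ← Finset.mul_sum, Finset.sum_boole]
    refine add_le_add (le_of_eq ?_) (le_of_eq ?_)
    · unfold seqCacheMisses
      rw [← sum_missesAt access (nodup_seqOrder h), ← List.sum_toFinset _ (nodup_seqOrder h)]
      refine Finset.sum_congr ?_ fun _ _ => rfl
      ext x
      simp [mem_seqOrder h x]
    · rw [← Set.ncard_coe_finset]
      simp
  · intro p _ q _ hpq
    simp only [Function.onFun]
    rw [Finset.disjoint_left]
    intro x hx hx'
    rw [List.mem_toFinset] at hx hx'
    exact hpq (i.trace_unique hx hx')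

end FutureGraph

/-! ### The potential of a configuration -/

namespace FutureGraph

section Potential

variable {V : Type*}

/-- The stack `l` is sorted by depth: strictly decreasing from the bottom to the top of the deque,
with the current node at least as deep as the nodes of the deque. -/
def DepthSorted (d : V → ℕ) : List V → Prop
  | [] => True
  | v :: R => (∀ u ∈ R, d u ≤ d v) ∧ R.Pairwise fun a b => d b < d a

/-- The weight of a node of depth `d v` in a deque. -/
noncomputable def weight (T : ℕ) (d : V → ℕ) (v : V) : ℝ := 9 ^ T / 9 ^ d v

/-- The potential of a processor with stack `l`, if `a` steal attempts have taken place since its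
last step, where `P` bounds the number of these. The current node counts one third of its weight,
and loses a proportion of `1 / (2 * P)` of that with each steal attempt. -/
noncomputable def potential (P T : ℕ) (d : V → ℕ) (a : ℕ) : List V → ℝ
  | [] => 0
  | v :: R => weight T d v / 3 * (1 - a / (2 * P)) + (R.map (weight T d)).sum

/-- The weight of the node at the top of the deque (`0` if the deque is empty). -/
noncomputable def topWeight (T : ℕ) (d : V → ℕ) (l : List V) : ℝ :=
  (l.tail.getLast?).elim 0 (weight T d)

variable {T : ℕ} {d d' : V → ℕ}

theorem weight_pos (v : V) : 0 < weight T d v := by unfold weight; positivity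

theorem weight_congr {v : V} (h : d' v = d v) : weight T d' v = weight T d v := by
  unfold weight; rw [h]

theorem weight_succ {u v : V} (h : d' u = d v + 1) : weight T d' u = weight T d v / 9 := by
  unfold weight; rw [h, pow_succ]; field_simp

theorem weight_le {u v : V} (h : d u ≤ d v) : weight T d v ≤ weight T d u := by
  unfold weight
  gcongr
  norm_num

theorem weight_le_of_lt {u v : V} (h : d u < d v) : weight T d v ≤ weight T d u / 9 := by
  unfold weight
  rw [div_div, ← pow_succ]
  gcongr
  · norm_num
  · exact h

theorem one_le_weight {v : V} (h : d v ≤ T) : 1 ≤ weight T d v := by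
  unfold weight
  rw [one_le_div (by positivity)]
  gcongr
  norm_num

theorem sum_weight_nonneg (R : List V) : 0 ≤ (R.map (weight T d)).sum :=
  List.sum_nonneg fun x hx => by
    obtain ⟨v, -, rfl⟩ := List.mem_map.1 hx
    exact (weight_pos v).le

theorem sum_weight_congr {R : List V} (h : ∀ v ∈ R, d' v = d v) :
    (R.map (weight T d')).sum = (R.map (weight T d)).sum := by
  rw [List.map_congr_left fun v hv => weight_congr (h v hv)]

theorem DepthSorted.congr {l : List V} (hl : DepthSorted d l) (h : ∀ v ∈ l, d' v = d v) :
    DepthSorted d' l := by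
  cases l with
  | nil => trivial
  | cons v R =>
    refine ⟨fun u hu => ?_, hl.2.imp_of_mem fun {a b} ha hb hab => ?_⟩
    · rw [h u (List.mem_cons_of_mem _ hu), h v (by simp)]
      exact hl.1 u hu
    · rw [h a (List.mem_cons_of_mem _ ha), h b (List.mem_cons_of_mem _ hb)]
      exact hab

theorem potential_congr {P a : ℕ} {l : List V} (h : ∀ v ∈ l, d' v = d v) :
    potential P T d' a l = potential P T d a l := by
  cases l with
  | nil => rfl
  | cons v R =>
    simp only [potential]
    rw [weight_congr (h v (by simp)), sum_weight_congr fun u hu => h u (List.mem_cons_of_mem _ hu)]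

theorem half_le_age_factor {P a : ℕ} (ha : a ≤ P) : (1 : ℝ) / 2 ≤ 1 - a / (2 * P) := by
  have h1 : (a : ℝ) ≤ P := by exact_mod_cast ha
  have h2 : (a : ℝ) / (2 * P) ≤ 1 / 2 := by
    rcases Nat.eq_zero_or_pos P with rfl | hP
    · simp
    · have : (0 : ℝ) < P := by exact_mod_cast hP
      rw [div_le_div_iff₀ (by positivity) (by norm_num)]
      linarith
  linarith

theorem age_factor_le_one (P a : ℕ) : (1 : ℝ) - a / (2 * P) ≤ 1 := by
  have : (0 : ℝ) ≤ a / (2 * P) := by positivity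
  linarith

theorem potential_nonneg {P a : ℕ} (ha : a ≤ P) (l : List V) : 0 ≤ potential P T d a l := by
  cases l with
  | nil => exact le_rfl
  | cons v R =>
    have h1 := sum_weight_nonneg (T := T) (d := d) R
    have h2 := half_le_age_factor ha
    have h3 := weight_pos (T := T) (d := d) v
    simp only [potential]
    have : 0 ≤ weight T d v / 3 * (1 - a / (2 * P)) := mul_nonneg (by linarith) (by linarith)
    linarith

/-- The weights in a deque grow at least ninefold from one node to the next, so their sum is
dominated by the last one. -/
theorem sum_weight_le_of_pairwise {u w : V} {R : List V}
    (hR : (u :: R).Pairwise fun a b => d b < d a) (hw : (u :: R).getLast? = some w) :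
    weight T d u / 3 + ((u :: R).map (weight T d)).sum ≤ 4 / 3 * weight T d w := by
  induction R generalizing u with
  | nil =>
    simp at hw
    subst hw
    simp
    linarith
  | cons u' R ih =>
    rw [List.pairwise_cons] at hR
    have h1 := weight_le_of_lt (T := T) (hR.1 u' (by simp))
    rw [List.getLast?_cons_cons] at hw
    have h2 := ih hR.2 hw
    have h3 := weight_pos (T := T) (d := d) u'
    rw [List.map_cons, List.sum_cons]
    have h4 := weight_pos (T := T) (d := d) u
    linarith

/-- The top of the deque carries three quarters of the potential of the processor. -/
theorem potential_le_topWeight {P a : ℕ} {v u : V} {R : List V} (hl : DepthSorted d (v :: u :: R)) :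
    potential P T d a (v :: u :: R) ≤ 4 / 3 * topWeight T d (v :: u :: R) := by
  obtain ⟨w, hw⟩ := Option.ne_none_iff_exists'.1
    (show (u :: R).getLast? ≠ none by simp)
  have h1 := sum_weight_le_of_pairwise (T := T) hl.2 hw
  have h2 := weight_le (T := T) (hl.1 u (by simp))
  have h3 := weight_pos (T := T) (d := d) v
  have h4 := age_factor_le_one P a
  have h5 : topWeight T d (v :: u :: R) = weight T d w := by
    simp only [topWeight, List.tail_cons, hw, Option.elim]
  have h6 : weight T d v / 3 * (1 - a / (2 * P)) ≤ weight T d v / 3 * 1 :=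
    mul_le_mul_of_nonneg_left h4 (by linarith)
  rw [h5]
  simp only [potential]
  linarith

/-- A steal attempt decreases the potential of each processor by a proportion `1 / (2 * P)`, in
expectation: a processor with a nonempty deque is the victim with probability `1 / P`, and then it
passes on the weight of its top node, a third of which remains; the current node of any other
processor ages. -/
theorem potential_attempt {P a : ℕ} (hP : 0 < P) {l : List V} (hl : DepthSorted d l) :
    potential P T d (a + 1) l - 2 / (3 * P) * topWeight T d l ≤
      (1 - 1 / (2 * P)) * potential P T d a l := by
  have hP' : (0 : ℝ) < P := by exact_mod_cast hP
  match l, hl with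
  | [], _ => simp [potential, topWeight]
  | [v], _ =>
    have h3 := weight_pos (T := T) (d := d) v
    simp only [potential, topWeight, List.tail_cons, List.getLast?_nil, Option.elim, List.map_nil,
      List.sum_nil, Nat.cast_add, Nat.cast_one]
    have h1 : (0 : ℝ) ≤ 1 / (2 * P) := by positivity
    have h2 : (0 : ℝ) ≤ a / (2 * P) := by positivity
    have h4 : 0 ≤ weight T d v / 3 * (1 / (2 * P) * (a / (2 * P))) := by positivity
    have h5 : ((a : ℝ) + 1) / (2 * P) = a / (2 * P) + 1 / (2 * P) := by ring
    rw [h5]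
    nlinarith
  | v :: u :: R, hl =>
    have h1 := potential_le_topWeight (T := T) (P := P) (a := a) hl
    have h2 : potential P T d (a + 1) (v :: u :: R) ≤ potential P T d a (v :: u :: R) := by
      simp only [potential]
      have h3 := weight_pos (T := T) (d := d) v
      gcongr
      simp
    have h3 : 1 / (2 * P) * potential P T d a (v :: u :: R) ≤
        1 / (2 * P) * (4 / 3 * topWeight T d (v :: u :: R)) :=
      mul_le_mul_of_nonneg_left h1 (by positivity)
    have h4 : (1 : ℝ) / (2 * P) * (4 / 3 * topWeight T d (v :: u :: R)) =
        2 / (3 * P) * topWeight T d (v :: u :: R) := by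
      field_simp; ring
    linarith

theorem potential_steal {P a : ℕ} {S : List V} (hS : S ≠ []) (w : V) :
    potential P T d a (S ++ [w]) = potential P T d a S + weight T d w ∧
      topWeight T d (S ++ [w]) = weight T d w := by
  cases S with
  | nil => exact absurd rfl hS
  | cons v R => simp [potential, topWeight, add_assoc]

theorem DepthSorted.of_append {S S' : List V} (h : DepthSorted d (S ++ S')) : DepthSorted d S := by
  cases S with
  | nil => trivial
  | cons v R =>
    exact ⟨fun u hu => h.1 u (List.mem_append_left _ hu), (List.pairwise_append.1 h.2).1⟩

/-- Executing a node does not increase the potential of its processor, and keeps the stack sorted: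
the current node has lost at most half of its share of the potential. -/
theorem potential_exec {P a : ℕ} (ha : a ≤ P) {v : V} {E R : List V}
    (hE : E = [] ∨ (∃ x, E = [x]) ∨ ∃ x y, E = [x, y]) (hEd : ∀ u ∈ E, d' u = d v + 1)
    (hRd : ∀ u ∈ R, d' u = d u) (hl : DepthSorted d (v :: R)) :
    potential P T d' 0 (E ++ R) ≤ potential P T d a (v :: R) ∧ DepthSorted d' (E ++ R) := by
  have h1 := half_le_age_factor ha
  have h2 := weight_pos (T := T) (d := d) v
  have h3 : weight T d v / 3 * (1 / 2) ≤ weight T d v / 3 * (1 - a / (2 * P)) :=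
    mul_le_mul_of_nonneg_left h1 (by linarith)
  have hR : R.Pairwise fun a b => d' b < d' a := hl.2.imp_of_mem fun {a b} ha hb hab => by
    rw [hRd a ha, hRd b hb]; exact hab
  have hle : ∀ u ∈ R, d' u ≤ d v := fun u hu => by rw [hRd u hu]; exact hl.1 u hu
  rcases hE with rfl | ⟨x, rfl⟩ | ⟨x, y, rfl⟩
  · rw [List.nil_append]
    cases R with
    | nil => exact ⟨potential_nonneg ha _, trivial⟩
    | cons u R =>
      rw [List.pairwise_cons] at hR
      refine ⟨?_, fun b hb => (hR.1 b hb).le, hR.2⟩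
      have h4 := weight_pos (T := T) (d := d) u
      simp only [potential, List.map_cons, List.sum_cons]
      rw [weight_congr (hRd u (by simp)),
        sum_weight_congr fun u hu => hRd u (List.mem_cons_of_mem _ hu)]
      simp only [Nat.cast_zero, zero_div, sub_zero, mul_one]
      linarith
  · have hx := hEd x (by simp)
    refine ⟨?_, fun b hb => ?_, hR⟩
    · simp only [List.cons_append, List.nil_append, potential]
      rw [weight_succ hx, sum_weight_congr hRd]
      simp only [Nat.cast_zero, zero_div, sub_zero, mul_one]
      linarith
    · have := hle b hb
      omega
  · have hx := hEd x (by simp)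
    have hy := hEd y (by simp)
    refine ⟨?_, fun b hb => ?_, ?_⟩
    · simp only [List.cons_append, List.nil_append, potential, List.map_cons, List.sum_cons]
      rw [weight_succ hx, weight_succ hy, sum_weight_congr hRd]
      simp only [Nat.cast_zero, zero_div, sub_zero, mul_one]
      linarith
    · rcases List.mem_cons.1 hb with rfl | hb
      · omega
      · have := hle b hb
        omega
    · refine List.pairwise_cons.2 ⟨fun b hb => ?_, hR⟩
      have := hle b hb
      omega

end Potential

section Ghost

variable {V : Type*} [DecidableEq V] [Fintype V] {P : ℕ} (G : FutureGraph V) (p₀ : Fin P)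
  (adv : Adversary P) (ω : ℕ → Fin P)

/-- The enabling depth of the nodes after `n` steps: a node enabled by `v` is one deeper than `v`. -/
def enablingDepth : ℕ → V → ℕ
  | 0 => fun _ => 0
  | n + 1 => fun w =>
    match (G.run p₀ adv ω n).current (scheduled adv ω n) with
    | some v => if w ∈ G.enabled (G.run p₀ adv ω (n + 1)) v then enablingDepth n v + 1
        else enablingDepth n w
    | none => enablingDepth n w

/-- The number of steal attempts since the last step of `p`, after `n` steps. -/
def age : ℕ → Fin P → ℕ
  | 0 => fun _ => 0
  | n + 1 => fun p =>
    if p = scheduled adv ω n then 0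
    else if (G.run p₀ adv ω n).current (scheduled adv ω n) = none then age n p + 1 else age n p

theorem hasPath_enablingDepth (n : ℕ) (v : V) :
    G.HasPath (G.enablingDepth p₀ adv ω n v) v := by
  induction n generalizing v with
  | zero => exact HasPath.zero G v
  | succ n ih =>
    unfold enablingDepth
    split
    · next u hu =>
      split_ifs with hv
      · exact (ih u).succ (mem_enabled.1 hv).1
      · exact ih v
    · exact ih v

/-- Since thieves yield to all, each other processor has made at most one steal attempt since
the last step of `p`. -/
theorem age_le (hY : G.YieldToAll p₀ adv) (n : ℕ) (p : Fin P) :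
    G.age p₀ adv ω n p ≤ P := by
  have key : ∃ m ≤ n, (∀ k, m ≤ k → k < n → scheduled adv ω k ≠ p) ∧
      ∃ A : Finset (Fin P), A.card = G.age p₀ adv ω n p ∧
        ∀ q ∈ A, ∃ k, m ≤ k ∧ k < n ∧ scheduled adv ω k = q ∧ G.StealAttempt p₀ adv ω k := by
    induction n with
    | zero => exact ⟨0, le_rfl, fun k _ hk => absurd hk (Nat.not_lt_zero k), ∅, rfl, by simp⟩
    | succ n ih =>
      obtain ⟨m, hm, hne, A, hA, hA'⟩ := ih
      have hold : ∀ q ∈ A, ∃ k, m ≤ k ∧ k < n + 1 ∧ scheduled adv ω k = q ∧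
          G.StealAttempt p₀ adv ω k := fun q hq => by
        obtain ⟨k, h1, h2, h3⟩ := hA' q hq
        exact ⟨k, h1, by omega, h3⟩
      by_cases hp : p = scheduled adv ω n
      · refine ⟨n + 1, le_rfl, fun k h1 h2 => absurd h2 (by omega), ∅, ?_, by simp⟩
        simp [age, hp]
      · have hne' : ∀ k, m ≤ k → k < n + 1 → scheduled adv ω k ≠ p := by
          intro k h1 h2
          rcases Nat.lt_succ_iff_lt_or_eq.1 h2 with h3 | rfl
          · exact hne k h1 h3
          · exact Ne.symm hp
        refine ⟨m, by omega, hne', ?_⟩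
        by_cases hs : (G.run p₀ adv ω n).current (scheduled adv ω n) = none
        · refine ⟨insert (scheduled adv ω n) A, ?_, ?_⟩
          · rw [Finset.card_insert_of_notMem, hA]
            · simp [age, hp, hs]
            · intro hmem
              obtain ⟨k, h1, h2, h3, h4⟩ := hA' _ hmem
              obtain ⟨j, hj1, hj2, hj3⟩ := hY ω k n h2 h3 h4 hs p hp
              exact hne j (by omega) hj2 hj3
          · intro q hq
            rcases Finset.mem_insert.1 hq with rfl | hq
            · exact ⟨n, hm, Nat.lt_succ_self n, rfl, hs⟩
            · exact hold q hq
        · exact ⟨A, by simp [age, hp, hs, hA], hold⟩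
  obtain ⟨-, -, -, A, hA, -⟩ := key
  rw [← hA]
  simpa using Finset.card_le_univ A

theorem enabled_cases (h : G.IsComputationDag) {s : WSState V P} {v : V} (hv : Executed s v) :
    G.enabled s v = [] ∨ (∃ x, G.enabled s v = [x]) ∨ ∃ x y, G.enabled s v = [x, y] := by
  cases hf : G.future v with
  | some a =>
    obtain ⟨b, -, he⟩ := enabled_fork h hv hf
    exact Or.inr (Or.inr ⟨a, b, he⟩)
  | none =>
    rcases enabled_nonfork (s := s) hf with he | ⟨b, -, -, he⟩ | ⟨x, -, -, he, -⟩ |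
      ⟨b, x, -, -, -, -, he⟩
    · exact Or.inl he
    · exact Or.inr (Or.inl ⟨b, he⟩)
    · exact Or.inr (Or.inl ⟨x, he⟩)
    · exact Or.inr (Or.inr ⟨b, x, he⟩)

/-- The potential of the configuration after `n` steps. -/
noncomputable def totalPotential (n : ℕ) : ℝ :=
  ∑ p, potential P G.span (G.enablingDepth p₀ adv ω n) (G.age p₀ adv ω n p)
    (stack (G.run p₀ adv ω n) p)

variable {G}

/-- The effect of the execution of a node on the ghost variables. -/
theorem exec_depth (h : G.IsComputationDag) (n : ℕ) {v : V} {R : List V}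
    (hc : (G.run p₀ adv ω n).current (scheduled adv ω n) = some v)
    (hs' : stack (G.run p₀ adv ω (n + 1)) = Function.update (stack (G.run p₀ adv ω n))
      (scheduled adv ω n) (G.enabled (G.run p₀ adv ω (n + 1)) v ++ R)) :
    (∀ u ∈ G.enabled (G.run p₀ adv ω (n + 1)) v,
      G.enablingDepth p₀ adv ω (n + 1) u = G.enablingDepth p₀ adv ω n v + 1) ∧
    (∀ u ∈ R, G.enablingDepth p₀ adv ω (n + 1) u = G.enablingDepth p₀ adv ω n u) ∧
    ∀ p, p ≠ scheduled adv ω n → ∀ u ∈ stack (G.run p₀ adv ω n) p,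
      G.enablingDepth p₀ adv ω (n + 1) u = G.enablingDepth p₀ adv ω n u := by
  have i := (isExecution_run G p₀ adv ω).inv h (n + 1)
  have hmem : ∀ u ∈ G.enabled (G.run p₀ adv ω (n + 1)) v,
      u ∈ stack (G.run p₀ adv ω (n + 1)) (scheduled adv ω n) := fun u hu => by
    rw [hs', Function.update_self]; exact List.mem_append_left _ hu
  have hnew : ∀ u, u ∉ G.enabled (G.run p₀ adv ω (n + 1)) v →
      G.enablingDepth p₀ adv ω (n + 1) u = G.enablingDepth p₀ adv ω n u := fun u hu => by
    simp [enablingDepth, hc, hu]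
  refine ⟨fun u hu => by simp [enablingDepth, hc, hu], fun u hu => hnew u fun hu' => ?_,
    fun p hp u hu => hnew u fun hu' => ?_⟩
  · have := i.nodup_stack (scheduled adv ω n)
    rw [hs', Function.update_self] at this
    exact List.disjoint_of_nodup_append this hu' hu
  · refine hp (i.stack_unique ?_ (hmem u hu'))
    rwa [hs', Function.update_of_ne hp]

theorem depthSorted (h : G.IsComputationDag) (n : ℕ) (p : Fin P) :
    DepthSorted (G.enablingDepth p₀ adv ω n) (stack (G.run p₀ adv ω n) p) := by
  have hr := isExecution_run G p₀ adv ω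
  induction n generalizing p with
  | zero =>
    rw [hr.zero]
    by_cases hp : p = p₀
    · subst hp; simp [stack, initState, DepthSorted]
    · simp [stack, initState, Function.update_of_ne hp, DepthSorted]
  | succ n ih =>
    have hsame : (G.run p₀ adv ω n).current (scheduled adv ω n) = none →
        G.enablingDepth p₀ adv ω (n + 1) = G.enablingDepth p₀ adv ω n := fun hc => by
      funext w; simp [enablingDepth, hc]
    cases hr.stepSpec h n with
    | idle hc hq he => rw [hsame hc, he]; exact ih p
    | steal w S hc hq hpq hpe hS hst ht hs' =>
      rw [hsame hc, hs']
      by_cases h1 : p = scheduled adv ω n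
      · subst h1; simp [DepthSorted]
      · rw [Function.update_of_ne h1]
        by_cases h2 : p = ω n
        · subst h2
          rw [Function.update_self]
          have := ih (ω n)
          rw [hst] at this
          exact this.of_append
        · rw [Function.update_of_ne h2]; exact ih p
    | exec v R hc hst ht hs' =>
      obtain ⟨h1, h2, h3⟩ := exec_depth p₀ adv ω h n hc hs'
      by_cases hp : p = scheduled adv ω n
      · subst hp
        have h4 := ih (scheduled adv ω n)
        rw [hst] at h4
        rw [hs', Function.update_self]
        exact (potential_exec (T := 0) (P := 0) le_rfl
          (G.enabled_cases h ((hr.executed_succ h).2 (Or.inr hc))) h1 h2 h4).2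
      · rw [hs', Function.update_of_ne hp]
        exact (ih p).congr (h3 p hp)

theorem totalPotential_nonneg (hY : G.YieldToAll p₀ adv) (n : ℕ) :
    0 ≤ G.totalPotential p₀ adv ω n :=
  Finset.sum_nonneg fun p _ => potential_nonneg (G.age_le p₀ adv ω hY n p) _

theorem totalPotential_zero :
    G.totalPotential p₀ adv ω 0 = 9 ^ G.span / 3 := by
  unfold totalPotential
  rw [Finset.sum_eq_single p₀]
  · simp [run, stack, initState, potential, age, weight, enablingDepth]
  · intro p _ hp
    simp [run, stack, initState, potential, Function.update_of_ne hp]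
  · simp

/-- A nonempty deque has potential at least one. -/
theorem one_le_totalPotential (h : G.IsComputationDag) (hY : G.YieldToAll p₀ adv) (n : ℕ)
    {q : Fin P} (hq : (G.run p₀ adv ω n).deque q ≠ []) : 1 ≤ G.totalPotential p₀ adv ω n := by
  have i := (isExecution_run G p₀ adv ω).inv h n
  refine le_trans ?_ (Finset.single_le_sum
    (fun p _ => potential_nonneg (G.age_le p₀ adv ω hY n p) _) (Finset.mem_univ q))
  obtain ⟨v, hv⟩ := Option.ne_none_iff_exists'.1 fun hc => hq (i.idle q hc)
  obtain ⟨u, R, hR⟩ := List.exists_cons_of_ne_nil hq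
  simp only [stack, hv, hR, Option.toList_some, List.cons_append, List.nil_append, potential,
    List.map_cons, List.sum_cons]
  have h1 := one_le_weight (T := G.span) ((G.hasPath_enablingDepth p₀ adv ω n u).le_span h)
  have h2 := sum_weight_nonneg (T := G.span) (d := G.enablingDepth p₀ adv ω n) R
  have h3 := half_le_age_factor (G.age_le p₀ adv ω hY n q)
  have h4 := weight_pos (T := G.span) (d := G.enablingDepth p₀ adv ω n) v
  have : 0 ≤ weight G.span (G.enablingDepth p₀ adv ω n) v / 3 *
      (1 - (G.age p₀ adv ω n q : ℝ) / (2 * P)) := mul_nonneg (by linarith) (by linarith)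
  linarith

theorem totalPotential_succ_le_of_exec (h : G.IsComputationDag) (hY : G.YieldToAll p₀ adv) (n : ℕ)
    (hc : ¬ G.StealAttempt p₀ adv ω n) :
    G.totalPotential p₀ adv ω (n + 1) ≤ G.totalPotential p₀ adv ω n := by
  have hr := isExecution_run G p₀ adv ω
  cases hr.stepSpec h n with
  | idle hc' hq he => exact absurd hc' hc
  | steal w S hc' hq hpq hpe hS hst ht hs' => exact absurd hc' hc
  | exec v R hc hst ht hs' =>
    obtain ⟨h1, h2, h3⟩ := exec_depth p₀ adv ω h n hc hs'
    refine Finset.sum_le_sum fun p _ => ?_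
    by_cases hp : p = scheduled adv ω n
    · subst hp
      have h4 := depthSorted p₀ adv ω h n (scheduled adv ω n)
      rw [hst] at h4
      rw [hs', Function.update_self, hst, show G.age p₀ adv ω (n + 1) (scheduled adv ω n) = 0 by
        simp [age]]
      exact (potential_exec (G.age_le p₀ adv ω hY n _)
          (G.enabled_cases h ((hr.executed_succ h).2 (Or.inr hc))) h1 h2 h4).1
    · rw [hs', Function.update_of_ne hp, potential_congr (h3 p hp),
        show G.age p₀ adv ω (n + 1) p = G.age p₀ adv ω n p by simp [age, hp, hc]]

/-- The potential after a steal attempt, in terms of the victim `ω n`. -/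
theorem totalPotential_succ_le_of_attempt (h : G.IsComputationDag) (n : ℕ)
    (hc : G.StealAttempt p₀ adv ω n) :
    G.totalPotential p₀ adv ω (n + 1) ≤
      (∑ p, potential P G.span (G.enablingDepth p₀ adv ω n) (G.age p₀ adv ω n p + 1)
        (stack (G.run p₀ adv ω n) p)) -
      2 / 3 * topWeight G.span (G.enablingDepth p₀ adv ω n) (stack (G.run p₀ adv ω n) (ω n)) := by
  have hr := isExecution_run G p₀ adv ω
  have i := hr.inv h n
  have hd : G.enablingDepth p₀ adv ω (n + 1) = G.enablingDepth p₀ adv ω n := by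
    funext w
    have : (G.run p₀ adv ω n).current (scheduled adv ω n) = none := hc
    simp [enablingDepth, this]
  have hage : ∀ p, p ≠ scheduled adv ω n →
      G.age p₀ adv ω (n + 1) p = G.age p₀ adv ω n p + 1 := fun p hp => by
    have : (G.run p₀ adv ω n).current (scheduled adv ω n) = none := hc
    simp [age, hp, this]
  have hage0 : G.age p₀ adv ω (n + 1) (scheduled adv ω n) = 0 := by simp [age]
  unfold totalPotential
  rw [hd]
  cases hr.stepSpec h n with
  | exec v R hc' hst ht hs' =>
    rw [StealAttempt, hc'] at hc
    cases hc
  | idle hc' hq he =>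
    have h0 : topWeight G.span (G.enablingDepth p₀ adv ω n)
        (stack (G.run p₀ adv ω n) (ω n)) = 0 := by
      unfold topWeight stack
      rw [hq]
      cases (G.run p₀ adv ω n).current (ω n) <;> simp
    rw [h0, mul_zero, sub_zero, he]
    refine Finset.sum_le_sum fun p _ => ?_
    by_cases hp : p = scheduled adv ω n
    · have : stack (G.run p₀ adv ω n) p = [] := by
        rw [hp]; simp [stack, hc', i.idle _ hc']
      rw [this]; exact le_rfl
    · rw [hage p hp]
  | steal w S hc' hq hpq hpe hS hst ht hs' =>
    rw [hs', hst, (potential_steal (P := P) (a := 0) hS w).2,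
      ← Finset.add_sum_erase _ _ (Finset.mem_univ (scheduled adv ω n)),
      ← Finset.add_sum_erase _ (fun p => potential P G.span (G.enablingDepth p₀ adv ω n)
        (G.age p₀ adv ω n p + 1) (stack (G.run p₀ adv ω n) p))
        (Finset.mem_univ (scheduled adv ω n)),
      ← Finset.add_sum_erase _ _ (Finset.mem_erase.2 ⟨hpq.symm, Finset.mem_univ (ω n)⟩),
      ← Finset.add_sum_erase _ (fun p => potential P G.span (G.enablingDepth p₀ adv ω n)
        (G.age p₀ adv ω n p + 1) (stack (G.run p₀ adv ω n) p))
        (Finset.mem_erase.2 ⟨hpq.symm, Finset.mem_univ (ω n)⟩)]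
    rw [Finset.sum_congr rfl (g := fun p => potential P G.span (G.enablingDepth p₀ adv ω n)
        (G.age p₀ adv ω n p + 1) (stack (G.run p₀ adv ω n) p))]
    · rw [Function.update_self, hage0, Function.update_of_ne hpq.symm, Function.update_self,
        hage _ hpq.symm, hst, hpe, (potential_steal hS w).1]
      simp only [potential, List.map_nil, List.sum_nil, Nat.cast_zero, zero_div, sub_zero, mul_one]
      linarith
    · intro p hp
      simp only [Finset.mem_erase, Finset.mem_univ, and_true] at hp
      rw [Function.update_of_ne hp.2, Function.update_of_ne hp.1, hage p hp.2]

end Ghost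

end FutureGraph

/-! ### The expected number of steals -/

section Draws

variable {P : ℕ} [NeZero P]

instance : IsProbabilityMeasure (victimLaw P) := by
  unfold victimLaw; infer_instance

omit [NeZero P] in
theorem measurable_update_pair (n : ℕ) :
    Measurable fun x : (ℕ → Fin P) × Fin P => Function.update x.1 n x.2 := by
  refine measurable_pi_lambda _ fun i => ?_
  by_cases h : i = n
  · subst h
    simpa using measurable_snd
  · simp only [Function.update_of_ne h]
    exact (measurable_pi_apply i).comp measurable_fst

/-- Drawing the `n`-th victim anew does not change the law of the draws. -/
theorem map_update_victimLaw (n : ℕ) :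
    ((victimLaw P).prod (PMF.uniformOfFintype (Fin P)).toMeasure).map
      (fun x => Function.update x.1 n x.2) = victimLaw P := by
  refine Measure.eq_infinitePi _ fun s t ht => ?_
  rw [Measure.map_apply (measurable_update_pair n)
    (MeasurableSet.pi s.countable_toSet fun i _ => ht i)]
  by_cases hn : n ∈ s
  · have : (fun x : (ℕ → Fin P) × Fin P => Function.update x.1 n x.2) ⁻¹' Set.pi s t =
        (Set.pi (s.erase n : Finset ℕ) t) ×ˢ t n := by
      ext x
      simp only [Set.mem_preimage, Set.mem_pi, Finset.mem_coe, Set.mem_prod, Finset.mem_erase]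
      constructor
      · intro h
        refine ⟨fun i hi => ?_, by simpa using h n hn⟩
        simpa [Function.update_of_ne hi.1] using h i hi.2
      · rintro ⟨h1, h2⟩ i hi
        by_cases hin : i = n
        · subst hin; simpa using h2
        · simpa [Function.update_of_ne hin] using h1 i ⟨hin, hi⟩
    rw [this, Measure.prod_prod, victimLaw, Measure.infinitePi_pi _ fun i _ => ht i,
      Finset.prod_erase_mul _ _ hn]
  · have : (fun x : (ℕ → Fin P) × Fin P => Function.update x.1 n x.2) ⁻¹' Set.pi s t =
        (Set.pi s t) ×ˢ Set.univ := by
      ext x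
      simp only [Set.mem_preimage, Set.mem_pi, Finset.mem_coe, Set.mem_prod, Set.mem_univ, and_true]
      refine forall₂_congr fun i hi => ?_
      have hin : i ≠ n := by rintro rfl; exact hn hi
      rw [Function.update_of_ne hin]
    rw [this, Measure.prod_prod, victimLaw, Measure.infinitePi_pi _ fun i _ => ht i, measure_univ,
      mul_one]

theorem lintegral_victimLaw_update {F : (ℕ → Fin P) → ℝ≥0∞} (hF : Measurable F) (n : ℕ) :
    ∫⁻ ω, F ω ∂(victimLaw P) =
      ∫⁻ ω, ∑ q, (P : ℝ≥0∞)⁻¹ * F (Function.update ω n q) ∂(victimLaw P) := by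
  conv_lhs => rw [← map_update_victimLaw n]
  rw [lintegral_map hF (measurable_update_pair n),
    lintegral_prod (fun x => F (Function.update x.1 n x.2)) (hF.comp (measurable_update_pair n)).aemeasurable]
  refine lintegral_congr fun ω => ?_
  rw [lintegral_fintype]
  refine Finset.sum_congr rfl fun q _ => ?_
  rw [PMF.toMeasure_apply_singleton _ _ (MeasurableSet.singleton q), PMF.uniformOfFintype_apply,
    Fintype.card_fin, mul_comm]

theorem measurable_of_forall_lt {β : Type*} [MeasurableSpace β] {F : (ℕ → Fin P) → β} (n : ℕ)
    (hF : ∀ ω ω', (∀ i < n, ω i = ω' i) → F ω = F ω') : Measurable F := by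
  have h1 : F = (fun x : Fin n → Fin P => F fun i => if h : i < n then x ⟨i, h⟩ else 0) ∘
      fun ω i => ω i := by
    funext ω
    refine hF _ _ fun i hi => ?_
    simp [hi]
  rw [h1]
  exact Measurable.of_discrete.comp (measurable_pi_lambda _ fun i => measurable_pi_apply _)

end Draws

namespace FutureGraph

section Steals

variable {V : Type*} [DecidableEq V] [Fintype V] {P : ℕ} (G : FutureGraph V) (p₀ : Fin P)
  (adv : Adversary P)

theorem scheduled_congr {n : ℕ} {ω ω' : ℕ → Fin P} (h : ∀ i < n, ω i = ω' i) :
    scheduled adv ω n = scheduled adv ω' n := by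
  unfold scheduled
  rw [List.map_congr_left fun i hi => h i (List.mem_range.1 hi)]

/-- The configuration and the ghost variables after `n` steps depend on the first `n` draws only. -/
theorem run_congr {n : ℕ} {ω ω' : ℕ → Fin P} (h : ∀ i < n, ω i = ω' i) :
    G.run p₀ adv ω n = G.run p₀ adv ω' n ∧
      G.enablingDepth p₀ adv ω n = G.enablingDepth p₀ adv ω' n ∧
      G.age p₀ adv ω n = G.age p₀ adv ω' n := by
  induction n with
  | zero => exact ⟨rfl, rfl, rfl⟩
  | succ n ih =>
    obtain ⟨h1, h2, h3⟩ := ih fun i hi => h i (by omega)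
    have h4 := scheduled_congr adv (n := n) fun i hi => h i (by omega)
    have h5 : G.run p₀ adv ω (n + 1) = G.run p₀ adv ω' (n + 1) := by
      rw [run, run, h1, h4, h n (Nat.lt_succ_self n)]
    refine ⟨h5, ?_, ?_⟩
    · funext w
      simp only [enablingDepth]
      rw [h1, h2, h4, h5]
    · funext p
      simp only [age]
      rw [h1, h3, h4]

theorem totalPotential_congr {n : ℕ} {ω ω' : ℕ → Fin P} (h : ∀ i < n, ω i = ω' i) :
    G.totalPotential p₀ adv ω n = G.totalPotential p₀ adv ω' n := by
  obtain ⟨h1, h2, h3⟩ := G.run_congr p₀ adv h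
  unfold totalPotential
  rw [h1, h2, h3]

theorem stealAttempt_congr {n : ℕ} {ω ω' : ℕ → Fin P} (h : ∀ i < n, ω i = ω' i) :
    G.StealAttempt p₀ adv ω n ↔ G.StealAttempt p₀ adv ω' n := by
  unfold StealAttempt
  rw [(G.run_congr p₀ adv h).1, scheduled_congr adv h]

/-- Step `n` is a steal attempt while some deque is nonempty. -/
def UsefulAttempt (ω : ℕ → Fin P) (n : ℕ) : Prop :=
  G.StealAttempt p₀ adv ω n ∧ ∃ q, (G.run p₀ adv ω n).deque q ≠ []

theorem usefulAttempt_congr {n : ℕ} {ω ω' : ℕ → Fin P} (h : ∀ i < n, ω i = ω' i) :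
    G.UsefulAttempt p₀ adv ω n ↔ G.UsefulAttempt p₀ adv ω' n := by
  unfold UsefulAttempt
  rw [(G.run_congr p₀ adv h).1, G.stealAttempt_congr p₀ adv h]

variable {G}

theorem update_agrees (ω : ℕ → Fin P) (n : ℕ) (q : Fin P) :
    ∀ i < n, Function.update ω n q i = ω i :=
  fun i hi => Function.update_of_ne (by omega) _ _

theorem sum_totalPotential_le (h : G.IsComputationDag) (hP : 0 < P) (ω : ℕ → Fin P) (n : ℕ)
    (hc : G.StealAttempt p₀ adv ω n) :
    ∑ q, G.totalPotential p₀ adv (Function.update ω n q) (n + 1) ≤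
      P * ((1 - 1 / (2 * P)) * G.totalPotential p₀ adv ω n) := by
  have hP' : (0 : ℝ) < P := by exact_mod_cast hP
  set d := G.enablingDepth p₀ adv ω n with hd
  set pot : Fin P → ℝ := fun p => potential P G.span d (G.age p₀ adv ω n p + 1)
    (stack (G.run p₀ adv ω n) p) with hpot
  set top : Fin P → ℝ := fun p => topWeight G.span d (stack (G.run p₀ adv ω n) p) with htop
  have h1 : ∀ q, G.totalPotential p₀ adv (Function.update ω n q) (n + 1) ≤
      (∑ p, pot p) - 2 / 3 * top q := by
    intro q
    have h2 := totalPotential_succ_le_of_attempt p₀ adv (Function.update ω n q) h n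
      ((G.stealAttempt_congr p₀ adv (update_agrees ω n q)).2 hc)
    obtain ⟨h3, h4, h5⟩ := G.run_congr p₀ adv (update_agrees ω n q)
    rw [h3, h4, h5, Function.update_self] at h2
    exact h2
  calc ∑ q, G.totalPotential p₀ adv (Function.update ω n q) (n + 1)
      ≤ ∑ q, ((∑ p, pot p) - 2 / 3 * top q) := Finset.sum_le_sum fun q _ => h1 q
    _ = P * ∑ p, (pot p - 2 / (3 * P) * top p) := by
        rw [Finset.sum_sub_distrib, Finset.sum_sub_distrib, ← Finset.mul_sum, ← Finset.mul_sum,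
          Finset.sum_const, Finset.card_univ, Fintype.card_fin, nsmul_eq_mul, mul_sub, ← mul_assoc]
        congr 2
        field_simp
    _ ≤ P * ∑ p, (1 - 1 / (2 * P)) * potential P G.span d (G.age p₀ adv ω n p)
          (stack (G.run p₀ adv ω n) p) :=
        mul_le_mul_of_nonneg_left (Finset.sum_le_sum fun p _ =>
          potential_attempt hP (depthSorted p₀ adv ω h n p)) hP'.le
    _ = P * ((1 - 1 / (2 * P)) * G.totalPotential p₀ adv ω n) := by
        rw [← Finset.mul_sum]; rfl

open Classical in
/-- In expectation, the logarithm of one plus the potential never increases, and a useful steal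
attempt decreases it by at least `1 / (4 * P)`. -/
theorem sum_log_totalPotential_le (h : G.IsComputationDag) (hY : G.YieldToAll p₀ adv) (hP : 0 < P)
    (ω : ℕ → Fin P) (n : ℕ) :
    (∑ q, (P : ℝ)⁻¹ *
      Real.log (1 + G.totalPotential p₀ adv (Function.update ω n q) (n + 1))) +
      (if G.UsefulAttempt p₀ adv ω n then (1 : ℝ) / (4 * P) else 0) ≤
    Real.log (1 + G.totalPotential p₀ adv ω n) := by
  have hP' : (0 : ℝ) < P := by exact_mod_cast hP
  set Φ := G.totalPotential p₀ adv ω n with hΦ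
  have hΦ0 : 0 ≤ Φ := totalPotential_nonneg p₀ adv ω hY n
  have hsum : ∀ c : ℝ, ∑ _q : Fin P, (P : ℝ)⁻¹ * c = c := fun c => by
    rw [Finset.sum_const, Finset.card_univ, Fintype.card_fin, nsmul_eq_mul]
    field_simp
  by_cases hc : G.StealAttempt p₀ adv ω n
  · -- the concave function `log` lies below its tangent at `1 + Φ`
    have h1 : ∀ q, Real.log (1 + G.totalPotential p₀ adv (Function.update ω n q) (n + 1)) ≤
        Real.log (1 + Φ) +
          (G.totalPotential p₀ adv (Function.update ω n q) (n + 1) - Φ) / (1 + Φ) := by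
      intro q
      have h2 := totalPotential_nonneg p₀ adv (Function.update ω n q) hY (n + 1)
      have h3 : 0 < (1 + G.totalPotential p₀ adv (Function.update ω n q) (n + 1)) / (1 + Φ) := by
        positivity
      have h4 := Real.log_le_sub_one_of_pos h3
      rw [Real.log_div (by positivity) (by positivity)] at h4
      have h5 : (1 + G.totalPotential p₀ adv (Function.update ω n q) (n + 1)) / (1 + Φ) - 1 =
          (G.totalPotential p₀ adv (Function.update ω n q) (n + 1) - Φ) / (1 + Φ) := by
        field_simp; ring
      linarith
    have h2 : ∑ q, (P : ℝ)⁻¹ *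
        Real.log (1 + G.totalPotential p₀ adv (Function.update ω n q) (n + 1)) ≤
        Real.log (1 + Φ) - 1 / (2 * P) * (Φ / (1 + Φ)) := by
      calc _ ≤ ∑ q, ((P : ℝ)⁻¹ * (Real.log (1 + Φ) - Φ / (1 + Φ)) + (P : ℝ)⁻¹ / (1 + Φ) *
            G.totalPotential p₀ adv (Function.update ω n q) (n + 1)) := by
            refine Finset.sum_le_sum fun q _ => ?_
            refine (mul_le_mul_of_nonneg_left (h1 q) (by positivity)).trans (le_of_eq ?_)
            ring
        _ = (Real.log (1 + Φ) - Φ / (1 + Φ)) + (P : ℝ)⁻¹ / (1 + Φ) *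
            ∑ q, G.totalPotential p₀ adv (Function.update ω n q) (n + 1) := by
            rw [Finset.sum_add_distrib, hsum, Finset.mul_sum]
        _ ≤ (Real.log (1 + Φ) - Φ / (1 + Φ)) + (P : ℝ)⁻¹ / (1 + Φ) *
            (P * ((1 - 1 / (2 * P)) * Φ)) := by
            gcongr
            exact sum_totalPotential_le p₀ adv h hP ω n hc
        _ = _ := by field_simp; ring
    split_ifs with hu
    · obtain ⟨-, q, hq⟩ := hu
      have h3 : 1 ≤ Φ := one_le_totalPotential p₀ adv ω h hY n hq
      have h4 : (1 : ℝ) / 2 ≤ Φ / (1 + Φ) := by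
        rw [div_le_div_iff₀ (by norm_num) (by linarith)]
        linarith
      have h5 : (1 : ℝ) / (4 * P) = 1 / (2 * P) * (1 / 2) := by field_simp; norm_num
      have h6 : (1 : ℝ) / (2 * P) * (1 / 2) ≤ 1 / (2 * P) * (Φ / (1 + Φ)) :=
        mul_le_mul_of_nonneg_left h4 (by positivity)
      linarith
    · have : 0 ≤ 1 / (2 * (P : ℝ)) * (Φ / (1 + Φ)) := by positivity
      linarith
  · rw [if_neg fun hu => hc hu.1, add_zero]
    calc _ ≤ ∑ _q : Fin P, (P : ℝ)⁻¹ * Real.log (1 + Φ) := by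
          refine Finset.sum_le_sum fun q _ => mul_le_mul_of_nonneg_left ?_ (by positivity)
          have h2 := totalPotential_nonneg p₀ adv (Function.update ω n q) hY (n + 1)
          refine Real.log_le_log (by positivity) (add_le_add le_rfl ?_)
          rw [hΦ, ← G.totalPotential_congr p₀ adv (update_agrees ω n q)]
          exact totalPotential_succ_le_of_exec p₀ adv _ h hY n fun hc' =>
            hc ((G.stealAttempt_congr p₀ adv (update_agrees ω n q)).1 hc')
      _ = _ := hsum _

variable [NeZero P]

open Classical in
theorem measurable_useful (c : ℝ≥0∞) (n : ℕ) :
    Measurable fun ω => if G.UsefulAttempt p₀ adv ω n then c else 0 :=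
  measurable_of_forall_lt n fun ω ω' h => by rw [propext (G.usefulAttempt_congr p₀ adv h)]

open Classical in
theorem lintegral_log_add_le (h : G.IsComputationDag) (hY : G.YieldToAll p₀ adv) (n : ℕ) :
    ∫⁻ ω, ENNReal.ofReal (Real.log (1 + G.totalPotential p₀ adv ω n)) ∂(victimLaw P) +
      ∑ m ∈ Finset.range n, ∫⁻ ω, (if G.UsefulAttempt p₀ adv ω m then
        ENNReal.ofReal (1 / (4 * P)) else 0) ∂(victimLaw P) ≤
      ENNReal.ofReal (Real.log (1 + 9 ^ G.span / 3)) := by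
  have hP : 0 < P := Nat.pos_of_neZero P
  have hPP : (0 : ℝ) < P := by exact_mod_cast hP
  induction n with
  | zero => simp [totalPotential_zero]
  | succ n ih =>
    refine le_trans ?_ ih
    rw [Finset.sum_range_succ, add_comm (Finset.sum _ _), ← add_assoc]
    gcongr
    rw [lintegral_victimLaw_update (measurable_of_forall_lt (n + 1) fun ω ω' h => by
      rw [G.totalPotential_congr p₀ adv h]) n, ← lintegral_add_right _
        (measurable_useful p₀ adv _ n)]
    refine lintegral_mono fun ω => ?_
    have hlog : ∀ ω n, 0 ≤ Real.log (1 + G.totalPotential p₀ adv ω n) := fun ω n =>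
      Real.log_nonneg (by have := totalPotential_nonneg p₀ adv ω hY n; linarith)
    have hle := ENNReal.ofReal_le_ofReal (sum_log_totalPotential_le p₀ adv h hY hP ω n)
    refine le_trans (le_of_eq ?_) hle
    rw [ENNReal.ofReal_add (Finset.sum_nonneg fun q _ => mul_nonneg (by positivity) (hlog _ _))
      (by split_ifs <;> positivity), ENNReal.ofReal_sum_of_nonneg
      fun q _ => mul_nonneg (by positivity) (hlog _ _)]
    congr 1
    · refine Finset.sum_congr rfl fun q _ => ?_
      rw [ENNReal.ofReal_mul (by positivity), ENNReal.ofReal_inv_of_pos hPP, ENNReal.ofReal_natCast]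
    · split_ifs <;> simp

open Classical in
/-- The expected number of useful steal attempts is of order `P * T`, where `T` is the span. -/
theorem lintegral_tsum_useful_le (h : G.IsComputationDag) (hY : G.YieldToAll p₀ adv)
    (hT : 0 < G.span) :
    ∫⁻ ω, ∑' m, (if G.UsefulAttempt p₀ adv ω m then 1 else 0) ∂(victimLaw P) ≤
      32 * P * (G.span : ℝ≥0∞) := by
  have hP : 0 < P := Nat.pos_of_neZero P
  have hPP : (0 : ℝ) < P := by exact_mod_cast hP
  have hlog : Real.log (1 + 9 ^ G.span / 3) ≤ 8 * G.span := by
    have h1 : (9 : ℝ) ≤ 9 ^ G.span := le_self_pow₀ (by norm_num) hT.ne'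
    calc Real.log (1 + 9 ^ G.span / 3) ≤ Real.log (9 ^ G.span) :=
          Real.log_le_log (by positivity) (by linarith)
      _ = G.span * Real.log 9 := Real.log_pow _ _
      _ ≤ G.span * 8 := by
          gcongr
          have := Real.log_le_sub_one_of_pos (show (0 : ℝ) < 9 by norm_num)
          linarith
      _ = 8 * G.span := mul_comm _ _
  rw [lintegral_tsum fun m => (measurable_useful p₀ adv 1 m).aemeasurable]
  refine ENNReal.tsum_le_of_sum_range_le fun n => ?_
  have h1 := le_trans le_add_self (lintegral_log_add_le p₀ adv h hY n)
  have h2 : ∀ m, ∫⁻ ω, (if G.UsefulAttempt p₀ adv ω m then (1 : ℝ≥0∞) else 0) ∂(victimLaw P) =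
      ENNReal.ofReal (4 * P) * ∫⁻ ω, (if G.UsefulAttempt p₀ adv ω m then
        ENNReal.ofReal (1 / (4 * P)) else 0) ∂(victimLaw P) := by
    intro m
    rw [← lintegral_const_mul _ (measurable_useful p₀ adv _ m)]
    refine lintegral_congr fun ω => ?_
    split_ifs
    · rw [← ENNReal.ofReal_mul (by positivity), mul_one_div_cancel (by positivity),
        ENNReal.ofReal_one]
    · simp
  rw [Finset.sum_congr rfl fun m _ => h2 m, ← Finset.mul_sum]
  calc _ ≤ ENNReal.ofReal (4 * P) * ENNReal.ofReal (8 * G.span) := by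
        gcongr
        exact h1.trans (ENNReal.ofReal_le_ofReal hlog)
    _ = ENNReal.ofReal ((32 * P * G.span : ℕ) : ℝ) := by
        rw [← ENNReal.ofReal_mul (by positivity)]
        congr 1
        push_cast
        ring
    _ = 32 * P * (G.span : ℝ≥0∞) := by
        rw [ENNReal.ofReal_natCast]
        push_cast
        rfl

omit [NeZero P] in
open Classical in
theorem card_stolen_le (ω : ℕ → Fin P) (n : ℕ) :
    (Finset.univ.filter fun x => Stolen (G.run p₀ adv ω) (scheduled adv ω) ω n x).card ≤
      ((Finset.range n).filter fun m => G.UsefulAttempt p₀ adv ω m).card := by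
  refine le_trans (Finset.card_le_card (t := ((Finset.range n).filter fun m =>
    G.UsefulAttempt p₀ adv ω m).image fun m =>
      ((G.run p₀ adv ω m).deque (ω m)).getLast?.getD G.root) ?_) Finset.card_image_le
  intro x hx
  obtain ⟨m, hm, hc, hd⟩ := (Finset.mem_filter.1 hx).2
  refine Finset.mem_image.2 ⟨m, Finset.mem_filter.2 ⟨Finset.mem_range.2 hm, hc, ω m, ?_⟩, ?_⟩
  · intro h0
    rw [h0] at hd
    simp at hd
  · simp only [hd, Option.getD_some]

open Classical in
theorem lintegral_deviations_le (h : G.IsComputationDag) (hs : G.IsStructuredLocalTouch)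
    (hY : G.YieldToAll p₀ adv) :
    ∫⁻ ω, G.deviations p₀ adv ω ∂(victimLaw P) ≤ 96 * P * (G.span : ℝ≥0∞) ^ 2 := by
  have h1 : ∀ ω, G.deviations p₀ adv ω ≤
      3 * G.span * ∑' m, (if G.UsefulAttempt p₀ adv ω m then 1 else 0) := by
    intro ω
    refine iSup_le fun n => ?_
    have h2 := ((isExecution_run G p₀ adv ω).ncard_deviations_le h hs n).trans
      (Nat.mul_le_mul_left _ (card_stolen_le p₀ adv ω n))
    have h3 : (((Finset.range n).filter fun m => G.UsefulAttempt p₀ adv ω m).card : ℝ≥0∞) ≤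
        ∑' m, (if G.UsefulAttempt p₀ adv ω m then 1 else 0) := by
      rw [← Finset.sum_boole]
      exact ENNReal.sum_le_tsum _
    calc _ ≤ ((3 * G.span *
          ((Finset.range n).filter fun m => G.UsefulAttempt p₀ adv ω m).card : ℕ) : ℝ≥0∞) := by
          exact_mod_cast h2
      _ ≤ _ := by
          push_cast
          gcongr
  refine (lintegral_mono h1).trans ?_
  rw [lintegral_const_mul' _ _ (by finiteness)]
  rcases Nat.eq_zero_or_pos G.span with hT | hT
  · simp [hT]
  · calc _ ≤ 3 * G.span * (32 * P * (G.span : ℝ≥0∞)) := by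
          gcongr
          exact lintegral_tsum_useful_le p₀ adv h hY hT
      _ = _ := by ring

end Steals

end FutureGraph

theorem mainTheorem4 :
    ∃ K : ℕ, ∀ (V : Type*) [Fintype V] [DecidableEq V] (G : FutureGraph V),
      G.IsComputationDag → G.IsStructuredLocalTouch →
      ∀ (P : ℕ) [NeZero P] (p₀ : Fin P) (adv : Adversary P), G.YieldToAll p₀ adv →
        ∫⁻ ω, G.deviations p₀ adv ω ∂(victimLaw P) ≤ K * P * (G.span : ℝ≥0∞) ^ 2 ∧
        ∀ (M : Type*) [DecidableEq M] (access : V → List M) (C : ℕ),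
          ∫⁻ ω, (G.cacheMisses C access p₀ adv ω - G.seqCacheMisses C access) ∂(victimLaw P) ≤
            K * C * P * (G.span : ℝ≥0∞) ^ 2 := by
  refine ⟨96, fun V _ _ G h hs P _ p₀ adv hY => ?_⟩
  have hdev := FutureGraph.lintegral_deviations_le p₀ adv h hs hY
  refine ⟨by exact_mod_cast hdev, fun M _ access C => ?_⟩
  have h1 : ∀ ω, G.cacheMisses C access p₀ adv ω - G.seqCacheMisses C access ≤
      C * G.deviations p₀ adv ω := by
    intro ω
    rw [tsub_le_iff_left]
    refine iSup_le fun n => ?_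
    have h2 := (FutureGraph.isExecution_run G p₀ adv ω).sum_lruMisses_le h C access n
    calc _ ≤ ((G.seqCacheMisses C access +
          C * {x | G.IsDeviation (G.run p₀ adv ω n) x}.ncard : ℕ) : ℝ≥0∞) := by exact_mod_cast h2
      _ ≤ _ := by
          push_cast
          gcongr
          exact le_iSup (fun n => (({x | G.IsDeviation (G.run p₀ adv ω n) x}.ncard : ℕ) : ℝ≥0∞)) n
  refine (lintegral_mono h1).trans ?_
  rw [lintegral_const_mul' _ _ (by finiteness)]
  calc _ ≤ C * (96 * P * (G.span : ℝ≥0∞) ^ 2) := by gcongr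
    _ = _ := by push_cast; ring
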